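/- Fix $d\ge 2$ and $K,h,r>0$. Let $(\Omega,\mathcal F,\mathbb P)$ be a probability space with a filtration $(\mathcal F_n)_{n\ge0}$, let $(\lambda_n)_{n\ge 0}$ be positive reals, $\ell\in\mathbb R^d$ with $\|\ell\|=1$, and let $A\subset\mathbb Z^d$ be nonempty. An adapted $\mathbb Z^d$-valued process $X=(X_n)_{n\ge0}$ with $X_0=0$ is called a $\lambda_n$-GERW in direction $\ell$ with excitation set $A$ (and constants $K,h,r$) if for all $n\ge 0$: (1) $\|X_{n+1}-X_n\|<K$ on every realization; (2) almost surely, $\mathbb E[X_{n+1}-X_n\mid\mathcal F_n]\cdot\ell\ge\lambda_n$ on the event $B_n=\{X_k\ne X_n\ \forall k<n\}\cap\{X_n\in A\}$, and $\mathbb E[X_{n+1}-X_n\mid\mathcal F_n]=0$ on the complement of $B_n$; (3) $\mathbb P[(X_{n+1}-X_n)\cdot\ell>r\mid\mathcal F_n]\ge h$ a.s., and for every unit vector $\ell'$, a.s. on the event $\{\mathbb E[X_{n+1}-X_n\mid\mathcal F_n]=0\}$, $\mathbb P[(X_{n+1}-X_n)\cdot\ell'>r\mid\mathcal F_n]\ge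 h$. Call $(\alpha,\gamma_1,\gamma_2)$ with $0<\alpha<1/6$ and $\gamma_1,\gamma_2>0$ admissible if for every such process (any probability space, filtration, $\lambda_n$, $\ell$, $A$, with the given $d,K,h,r$) and every $n\ge1$, $$\mathbb P\big[\,|\{X_0,\dots,X_n\}|<n^{\frac12+\alpha}\,\big]<\exp(-\gamma_1n^{\gamma_2}).$$ Then an admissible triple exists. Moreover, let $(\alpha,\gamma_1,\gamma_2)$ be any admissible triple, $\beta<\alpha$ and $\lambda>0$, and put $\delta=(2-\alpha+\beta)(\tfrac12+\alpha-\beta)$, $$\vartheta_1=\min\Big\{\gamma_1,\frac1{2K^2},\frac{\lambda^2}{18K^2},\frac{((1/3-2^{1-\beta}/3)\lambda)^2}{2K^2}\Big\},\qquad \vartheta_2=\min\{\gamma_2,2(\alpha-\beta)\},$$ $$\varphi_1=\min\{\alpha-\beta,(2-\alpha+\beta)\vartheta_2\},\qquad \eta=\Big(\frac{2-\alpha+\beta}{\vartheta_1\varphi_1}\Big)^{1/\varphi_1}.$$ Then there are constants $C_0\ge K^{\frac1{\delta-1}}\big(\eta+\lceil r^{-1}\rceil^{\frac1{\delta-1}}\big)$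 and $c\in(0,1)$, depending only on $d,K,h,r,\alpha,\gamma_1,\gamma_2,\beta,\lambda$, such that for every $n_0\in\mathbb N=\{0,1,2,\dots\}$ and every $C\ge C_0+n_0$ the number $$\psi=h^{\lceil r^{-1}\rceil\,C\,(3/\lambda)^{1/(\delta-1)}}\,c$$ is positive, and every $\lambda_n$-GERW $X$ in direction $\ell$ with excitation set $A\supset\mathbb M_\ell=\{x\in\mathbb Z^d:x\cdot\ell>0\}$ and constants $K,h,r$, such that $\lambda_n\ge\lambda(n_0+n)^{-\beta}$ for all $n\ge1$, satisfies $$\mathbb P[X_n\cdot\ell>0\ \text{ for all } n\ge1]\ge\psi .$$ (For $\beta<0$ there is no such process, so the claim is empty there, and any convention may be used where a formula above is undefined, as for $\delta=1$.) -/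

import Mathlib

open MeasureTheory ProbabilityTheory

universe u

/-- The point `x` of the lattice `ℤ^d`, seen in Euclidean space `ℝ^d`. -/
noncomputable def latticePoint {d : ℕ} (x : Fin d → ℤ) : EuclideanSpace ℝ (Fin d) :=
  WithLp.toLp 2 (fun i => (x i : ℝ))

/-- The positive half-space `{x ∈ ℤ^d : x · ℓ > 0}` in direction `ℓ`. -/
def positiveHalfSpace {d : ℕ} (ℓ : EuclideanSpace ℝ (Fin d)) : Set (Fin d → ℤ) :=
  {x | 0 < inner ℝ (latticePoint x) ℓ}

/-- The increment `X_{n+1} - X_n`, as a vector of `ℝ^d`. -/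
noncomputable def increment {d : ℕ} {Ω : Type u} (X : ℕ → Ω → (Fin d → ℤ)) (n : ℕ) (ω : Ω) :
    EuclideanSpace ℝ (Fin d) :=
  latticePoint (X (n + 1) ω) - latticePoint (X n ω)

/-- At time `n` the process is at a site of `A` that it visits for the first time. -/
def IsExcitedAt {d : ℕ} {Ω : Type u} (A : Set (Fin d → ℤ)) (X : ℕ → Ω → (Fin d → ℤ))
    (n : ℕ) (ω : Ω) : Prop :=
  (∀ k < n, X k ω ≠ X n ω) ∧ X n ω ∈ A

/-- `X` is a `λ_n`-GERW (generalized excited random walk) in direction `ℓ` with excitation set `A`,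
adapted to the filtration `ℱ` of the probability space `(Ω, μ)`, with the constants `K` (bound on
the increments) and `h`, `r` (uniform ellipticity). Here `drift n` is `λ_n`. -/
structure IsGERW {d : ℕ} {Ω : Type u} {mΩ : MeasurableSpace Ω} (μ : Measure Ω)
    (ℱ : Filtration ℕ mΩ) (K h r : ℝ) (drift : ℕ → ℝ) (ℓ : EuclideanSpace ℝ (Fin d))
    (A : Set (Fin d → ℤ)) (X : ℕ → Ω → (Fin d → ℤ)) : Prop where
  norm_direction : ‖ℓ‖ = 1
  drift_pos : ∀ n, 0 < drift n
  nonempty : A.Nonempty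
  adapted : ∀ n, Measurable[ℱ n] (X n)
  start : ∀ ω, X 0 ω = 0
  /-- bounded increments, on every realization -/
  bounded : ∀ n ω, ‖increment X n ω‖ < K
  /-- drift on the first visits to the sites of `A` -/
  drift_le : ∀ n, ∀ᵐ ω ∂μ, IsExcitedAt A X n ω →
    drift n ≤ inner ℝ ((μ[increment X n | ℱ n]) ω) ℓ
  /-- no drift otherwise -/
  drift_eq_zero : ∀ n, ∀ᵐ ω ∂μ, ¬ IsExcitedAt A X n ω → (μ[increment X n | ℱ n]) ω = 0
  /-- uniform ellipticity in direction `ℓ` -/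
  elliptic_direction : ∀ n, ∀ᵐ ω ∂μ,
    h ≤ (μ⟦{ω' | r < inner ℝ (increment X n ω') ℓ} | ℱ n⟧) ω
  /-- uniform ellipticity in every direction on the event of zero drift -/
  elliptic_of_drift_eq_zero : ∀ n, ∀ ℓ' : EuclideanSpace ℝ (Fin d), ‖ℓ'‖ = 1 → ∀ᵐ ω ∂μ,
    (μ[increment X n | ℱ n]) ω = 0 →
      h ≤ (μ⟦{ω' | r < inner ℝ (increment X n ω') ℓ'} | ℱ n⟧) ω

/-- The set of sites visited up to time `n`. -/
def visitedSites {d : ℕ} {Ω : Type u} (X : ℕ → Ω → (Fin d → ℤ)) (n : ℕ) (ω : Ω) :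
    Finset (Fin d → ℤ) :=
  (Finset.range (n + 1)).image (fun k => X k ω)

/-- `α ∈ (0, 1/6)` and `γ₁, γ₂ > 0` are constants such that every generalized excited random walk in
`ℤ^d` with the constants `K`, `h`, `r` visits at least `n ^ (1/2 + α)` sites up to time `n`, except
with probability less than `exp (-γ₁ n ^ γ₂)`. -/
structure IsRangeExponent (d : ℕ) (K h r α γ₁ γ₂ : ℝ) : Prop where
  pos : 0 < α
  lt_sixth : α < 1 / 6
  pos₁ : 0 < γ₁
  pos₂ : 0 < γ₂
  bound : ∀ (Ω : Type u) (mΩ : MeasurableSpace Ω) (μ : Measure Ω) [IsProbabilityMeasure μ]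
    (ℱ : Filtration ℕ mΩ) (drift : ℕ → ℝ) (ℓ : EuclideanSpace ℝ (Fin d)) (A : Set (Fin d → ℤ))
    (X : ℕ → Ω → (Fin d → ℤ)), IsGERW μ ℱ K h r drift ℓ A X → ∀ n : ℕ, 1 ≤ n →
      μ.real {ω | ((visitedSites X n ω).card : ℝ) < (n : ℝ) ^ (1 / 2 + α)}
        < Real.exp (-γ₁ * (n : ℝ) ^ γ₂)

/-- The constant `ϑ₁`. -/
noncomputable def vartheta₁ (K lam β γ₁ : ℝ) : ℝ :=
  min γ₁ (min (1 / (2 * K ^ 2)) (min (lam ^ 2 / (18 * K ^ 2))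
    (((1 / 3 - (2 : ℝ) ^ (1 - β) / 3) * lam) ^ 2 / (2 * K ^ 2))))

/-- The constant `ϑ₂`. -/
noncomputable def vartheta₂ (α β γ₂ : ℝ) : ℝ := min γ₂ (2 * (α - β))

/-- The constant `φ₁`. -/
noncomputable def varphi₁ (α β γ₂ : ℝ) : ℝ :=
  min (α - β) ((2 - α + β) * vartheta₂ α β γ₂)

/-- The constant `η`. -/
noncomputable def etaConst (K lam α β γ₁ γ₂ : ℝ) : ℝ :=
  ((2 - α + β) / (vartheta₁ K lam β γ₁ * varphi₁ α β γ₂)) ^ (1 / varphi₁ α β γ₂)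

/-- The exponent `δ`. -/
noncomputable def deltaExp (α β : ℝ) : ℝ := (2 - α + β) * (1 / 2 + α - β)

/-- The lower bound `h ^ (⌈1/r⌉ C (3/λ) ^ (1/(δ-1))) c` for the probability of never returning. -/
noncomputable def psiConst (h r lam α β C c : ℝ) : ℝ :=
  h ^ ((⌈r⁻¹⌉₊ : ℝ) * C * (3 / lam) ^ (1 / (deltaExp α β - 1))) * c

/-! Existence of a range exponent. Suppose that up to time `n` the walk sees fewer than `N = n ^
(1/2 + α)` sites. Then some site `y` is visited at least `n / N` times, and this is refuted with the
function `f(x) = (‖x - y‖² + L) ^ p` for `p` slightly below `1/2`. On a step `D` without drift the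
second-order term of `f` is governed by `‖D‖² - 2 (1 - p) ⟨x - y, D⟩² / (‖x - y‖² + L)`. Since `2 (1
- p)` is close to `1` and `d ≥ 2`, this is nearly bounded below by the square of the component of
`D` along a unit vector orthogonal to `x - y`, and ellipticity makes the mean of that square at
least `h r²`. So `f` is a submartingale along such steps, with a fixed gain at each visit of `y`
(`exists_isLyapunov`).

An excited step can lower `f` by at most a constant times `dist ^ (2p - 1)`. Excited sites are
distinct, so the total loss is `O(N ^ (1 - κ))` for some `κ > 0` (`sum_regDist_rpow_le`). The
displacement is `O(N)`: unexcited steps are controlled by Hoeffding's lemma, and there are fewer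
than `N` excited ones. Hence `f` ends at `O(N ^ (2p))`, and `n / N` visits are too many if `α` is
small compared with `κ`. In exponential form (`measureReal_visits_le`) the error survives a union
bound over polynomially many sites `y`. Small `n` are covered by the event that all steps go forward
in direction `ℓ`.

Escape. With probability at least `h ^ m` the first `m` steps each gain more than `r` in direction
`ℓ`. Conditioned on its path so far, the walk restarts as a GERW at height at least `r m`, and its
excitation set contains the half-space except for at most `m` old sites (`isGERW_restart`). It
remains to show that it then stays positive with probability at least `1/2`, uniformly in large `m`
(`exists_half_le_measureReal_stay`). Short times are harmless because increments are bounded. While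
`n ^ (1/2 + α)` is at most of order `m`, the height beats diffusive fluctuations. Later, before
leaving the half-space the walk has seen `n ^ (1/2 + α)` sites, most of them excited, so its drift
is of order `n ^ (1/2 + α - β)`, which beats fluctuations since `β < α`. Azuma's inequality makes
all errors summable.

A threshold `m₀` that does not depend on `n₀` is absorbed into `c`. Only about `s n₀` further pushes
are needed, where `s` is the factor of `C` in the exponent of `ψ`, and `C ≥ n₀` pays for them. -/

namespace GERW

/-! ### Localized conditional expectations and Hoeffding's lemma -/

section CondExp

variable {Ω : Type*} {m m0 : MeasurableSpace Ω} {μ : Measure Ω}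

theorem condExp_le_condExp_on [IsFiniteMeasure μ] (hm : m ≤ m0) {s : Set Ω}
    (hs : MeasurableSet[m] s) {f g : Ω → ℝ} (hf : Integrable f μ) (hg : Integrable g μ)
    (hfg : ∀ ω ∈ s, f ω ≤ g ω) : ∀ᵐ ω ∂μ, ω ∈ s → (μ[f | m]) ω ≤ (μ[g | m]) ω := by
  have h1 : μ[s.indicator f | m] ≤ᵐ[μ] μ[s.indicator g | m] := by
    refine condExp_mono (hf.indicator (hm s hs)) (hg.indicator (hm s hs)) (.of_forall fun ω => ?_)
    by_cases h : ω ∈ s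
    · simpa [h] using hfg ω h
    · simp [h]
  filter_upwards [h1, condExp_indicator hf hs, condExp_indicator hg hs] with ω h1 h2 h3 hω
  rw [h2, h3] at h1
  simpa [hω] using h1

theorem condExp_le_one_on [IsFiniteMeasure μ] (hm : m ≤ m0) {s : Set Ω}
    (hs : MeasurableSet[m] s) {f : Ω → ℝ} (hf : Integrable f μ)
    (hfg : ∀ ω ∈ s, f ω ≤ 1) : ∀ᵐ ω ∂μ, ω ∈ s → (μ[f | m]) ω ≤ 1 := by
  have := condExp_le_condExp_on hm hs hf (integrable_const (1 : ℝ)) hfg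
  rwa [condExp_const hm (1 : ℝ)] at this

theorem integrable_of_abs_le [IsFiniteMeasure μ] {f : Ω → ℝ} (hf : Measurable f) (C : ℝ)
    (h : ∀ ω, |f ω| ≤ C) : Integrable f μ :=
  Integrable.of_bound hf.aestronglyMeasurable C (.of_forall h)

theorem integrable_exp_of_le [IsFiniteMeasure μ] {f : Ω → ℝ} (hf : Measurable f) (C : ℝ)
    (h : ∀ ω, f ω ≤ C) : Integrable (fun ω => Real.exp (f ω)) μ :=
  integrable_of_abs_le (Real.measurable_exp.comp hf) (Real.exp C) fun ω => by
    rw [abs_of_pos (Real.exp_pos _)]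
    exact Real.exp_le_exp.2 (h ω)

/-- Hoeffding's lemma, one-sided and localized on an event of the conditioning `σ`-algebra. -/
theorem condExp_exp_le_one [IsFiniteMeasure μ] (hm : m ≤ m0) {U : Ω → ℝ} (hU : Measurable U)
    {B t : ℝ} (hB : 0 < B) (ht : 0 ≤ t) (hUB : ∀ ω, |U ω| ≤ B) {s : Set Ω}
    (h0 : ∀ᵐ ω ∂μ, ω ∈ s → 0 ≤ (μ[U | m]) ω) :
    ∀ᵐ ω ∂μ, ω ∈ s → (μ[fun ω => Real.exp (-t * U ω - t ^ 2 * B ^ 2 / 2) | m]) ω ≤ 1 := by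
  set q := Real.exp (-(t ^ 2 * B ^ 2 / 2)) with hq
  have hUi : Integrable U μ := integrable_of_abs_le hU B hUB
  set a := q * Real.cosh (t * B) with ha
  set b := q * (Real.sinh (t * B) / B) with hb
  have hb0 : 0 ≤ b := by
    have : 0 ≤ Real.sinh (t * B) := Real.sinh_nonneg_iff.2 (by positivity)
    positivity
  have ha1 : a ≤ 1 := by
    have := Real.cosh_le_exp_half_sq (t * B)
    calc a ≤ q * Real.exp ((t * B) ^ 2 / 2) :=
        mul_le_mul_of_nonneg_left this (Real.exp_pos _).le
      _ = 1 := by rw [hq, ← Real.exp_add]; ring_nf; simp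
  -- By convexity the exponential lies below its chord on `[-B, B]`. The slope of the chord in `U`
  -- is nonpositive, so `0 ≤ μ[U | m]` is enough.
  have hpt : ∀ ω, Real.exp (-t * U ω - t ^ 2 * B ^ 2 / 2) ≤ a + (-b) * U ω := by
    intro ω
    have h1 : |-(U ω / B)| ≤ 1 := by
      rw [abs_neg, abs_div, abs_of_pos hB]; exact (div_le_one hB).2 (hUB ω)
    have h2 := Real.exp_mul_le_cosh_add_mul_sinh h1 (t * B)
    have h3 : -(U ω / B) * (t * B) = -t * U ω := by field_simp
    rw [h3] at h2
    rw [sub_eq_add_neg, Real.exp_add, mul_comm]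
    calc q * Real.exp (-t * U ω)
        ≤ q * (Real.cosh (t * B) + -(U ω / B) * Real.sinh (t * B)) := by gcongr
      _ = _ := by rw [ha, hb]; ring
  have hmeas : Measurable fun ω => -t * U ω - t ^ 2 * B ^ 2 / 2 := by fun_prop
  have h1 : μ[fun ω => Real.exp (-t * U ω - t ^ 2 * B ^ 2 / 2) | m]
      ≤ᵐ[μ] μ[(fun _ => a) + (-b) • U | m] := by
    refine condExp_mono (integrable_exp_of_le hmeas (t * B) fun ω => ?_)
      ((integrable_const a).add (hUi.smul _)) (.of_forall hpt)
    have := (abs_le.1 (hUB ω)).1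
    have : t * (-U ω) ≤ t * B := by gcongr; linarith
    nlinarith [sq_nonneg (t * B)]
  filter_upwards [h0, h1, condExp_add (integrable_const a) (hUi.smul (-b)) m,
    condExp_smul (-b) U m (μ := μ)] with ω h0 h1 h2 h3 hω
  refine h1.trans ?_
  rw [h2, Pi.add_apply, h3, condExp_const hm a]
  simp only [Pi.smul_apply, smul_eq_mul]
  nlinarith [mul_nonneg hb0 (h0 hω)]

end CondExp

/-! ### Exponential supermartingales -/

section Supermartingale

variable {Ω : Type*} {mΩ : MeasurableSpace Ω} {μ : Measure Ω} [IsProbabilityMeasure μ]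
  {ℱ : Filtration ℕ mΩ} {ξ : ℕ → Ω → ℝ}

theorem measurable_sum_range (hξ : ∀ k, Measurable[ℱ (k + 1)] (ξ k)) (n : ℕ) :
    Measurable[ℱ n] fun ω => ∑ k ∈ Finset.range n, ξ k ω :=
  Finset.measurable_sum _ fun k hk =>
    (hξ k).mono (ℱ.mono (by simpa using hk)) le_rfl

theorem sum_range_le_of_bounded (hb : ∀ k, ∃ C, ∀ ω, ξ k ω ≤ C) (n : ℕ) :
    ∃ C, ∀ ω, ∑ k ∈ Finset.range n, ξ k ω ≤ C := by
  choose C hC using hb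
  exact ⟨∑ k ∈ Finset.range n, C k, fun ω => Finset.sum_le_sum fun k _ => hC k ω⟩

/-- Conditioning on `ℱ n` pulls out the exponential of the first `n` terms, and the remaining factor
has conditional mean at most one. Upper bounds on the `ξ k` suffice for integrability. -/
theorem integral_exp_sum_le_one (hξ : ∀ k, Measurable[ℱ (k + 1)] (ξ k))
    (hb : ∀ k, ∃ C, ∀ ω, ξ k ω ≤ C)
    (hle : ∀ k, ∀ᵐ ω ∂μ, (μ[fun ω => Real.exp (ξ k ω) | ℱ k]) ω ≤ 1) (n : ℕ) :
    ∫ ω, Real.exp (∑ k ∈ Finset.range n, ξ k ω) ∂μ ≤ 1 := by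
  have hint : ∀ n, Integrable (fun ω => Real.exp (∑ k ∈ Finset.range n, ξ k ω)) μ := fun n => by
    obtain ⟨C, hC⟩ := sum_range_le_of_bounded hb n
    exact integrable_exp_of_le ((measurable_sum_range hξ n).mono (ℱ.le n) le_rfl) C hC
  induction n with
  | zero => simp
  | succ n ih =>
    refine le_trans ?_ ih
    set W : Ω → ℝ := fun ω => Real.exp (∑ k ∈ Finset.range n, ξ k ω) with hW
    have hWm : StronglyMeasurable[ℱ n] W :=
      (Real.measurable_exp.comp (measurable_sum_range hξ n)).stronglyMeasurable
    have hprod : (fun ω => Real.exp (∑ k ∈ Finset.range (n + 1), ξ k ω))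
        = W * fun ω => Real.exp (ξ n ω) := by
      ext ω; simp [hW, Finset.sum_range_succ, Real.exp_add]
    obtain ⟨C, hC⟩ := hb n
    have hi : Integrable (fun ω => Real.exp (ξ n ω)) μ :=
      integrable_exp_of_le ((hξ n).mono (ℱ.le _) le_rfl) C hC
    rw [hprod, ← integral_condExp (ℱ.le n)]
    have hip : Integrable (W * fun ω => Real.exp (ξ n ω)) μ := hprod ▸ hint (n + 1)
    refine integral_mono_ae integrable_condExp (hint n) ?_
    filter_upwards [condExp_mul_of_stronglyMeasurable_left hWm hip hi, hle n] with ω h1 h2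
    rw [h1]
    calc W ω * _ ≤ W ω * 1 := mul_le_mul_of_nonneg_left h2 (Real.exp_pos _).le
      _ = _ := mul_one _

theorem measureReal_le_exp_neg (hξ : ∀ k, Measurable[ℱ (k + 1)] (ξ k))
    (hb : ∀ k, ∃ C, ∀ ω, ξ k ω ≤ C)
    (hle : ∀ k, ∀ᵐ ω ∂μ, (μ[fun ω => Real.exp (ξ k ω) | ℱ k]) ω ≤ 1) (n : ℕ) (a : ℝ) :
    μ.real {ω | a ≤ ∑ k ∈ Finset.range n, ξ k ω} ≤ Real.exp (-a) := by
  have hint : Integrable (fun ω => Real.exp (∑ k ∈ Finset.range n, ξ k ω)) μ := by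
    obtain ⟨C, hC⟩ := sum_range_le_of_bounded hb n
    exact integrable_exp_of_le ((measurable_sum_range hξ n).mono (ℱ.le n) le_rfl) C hC
  have h1 := mul_meas_ge_le_integral_of_nonneg (μ := μ)
    (.of_forall fun ω => (Real.exp_pos (∑ k ∈ Finset.range n, ξ k ω)).le) hint (Real.exp a)
  have h2 := h1.trans (integral_exp_sum_le_one hξ hb hle n)
  simp only [Real.exp_le_exp] at h2
  rw [Real.exp_neg, ← one_div, le_div_iff₀ (Real.exp_pos _), mul_comm]
  exact h2

end Supermartingale

/-! ### Measurability and elementary bounds for the walk -/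

section Walk

variable {d : ℕ} {Ω : Type u} {mΩ : MeasurableSpace Ω} {μ : Measure Ω} {ℱ : Filtration ℕ mΩ}
  {K h r : ℝ} {drift : ℕ → ℝ} {ℓ : EuclideanSpace ℝ (Fin d)} {A : Set (Fin d → ℤ)}
  {X : ℕ → Ω → (Fin d → ℤ)}

theorem measurable_comp_walk {β : Type*} [MeasurableSpace β] (hX : ∀ n, Measurable[ℱ n] (X n))
    {k n : ℕ} (hkn : k ≤ n) (f : (Fin d → ℤ) → β) : Measurable[ℱ n] fun ω => f (X k ω) :=
  (measurable_of_countable f).comp ((hX k).mono (ℱ.mono hkn) le_rfl)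

theorem measurableSet_walk_mem (hX : ∀ n, Measurable[ℱ n] (X n)) {k n : ℕ} (hkn : k ≤ n)
    (S : Set (Fin d → ℤ)) : MeasurableSet[ℱ n] {ω | X k ω ∈ S} :=
  ((hX k).mono (ℱ.mono hkn) le_rfl) S.to_countable.measurableSet

theorem measurable_increment (hX : ∀ n, Measurable[ℱ n] (X n)) (n : ℕ) :
    Measurable[ℱ (n + 1)] (increment X n) :=
  (measurable_comp_walk hX le_rfl latticePoint).sub
    (measurable_comp_walk hX n.le_succ latticePoint)

theorem measurable_inner_increment (hX : ∀ n, Measurable[ℱ n] (X n)) (n : ℕ)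
    (e : EuclideanSpace ℝ (Fin d)) :
    Measurable[ℱ (n + 1)] fun ω => inner ℝ (increment X n ω) e :=
  (measurable_increment hX n).inner_const

theorem measurableSet_isExcitedAt (hX : ∀ n, Measurable[ℱ n] (X n)) (n : ℕ) :
    MeasurableSet[ℱ n] {ω | IsExcitedAt A X n ω} := by
  have h1 : {ω | IsExcitedAt A X n ω}
      = (⋂ k ∈ Finset.range n, {ω | X k ω = X n ω}ᶜ) ∩ {ω | X n ω ∈ A} := by
    ext ω; simp [IsExcitedAt]
  rw [h1]
  refine (Finset.measurableSet_biInter _ fun k hk => ?_).inter (measurableSet_walk_mem hX le_rfl A)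
  exact (measurableSet_eq_fun ((hX k).mono (ℱ.mono (Finset.mem_range.1 hk).le) le_rfl)
    (hX n)).compl

theorem abs_inner_increment_le (hb : ∀ n ω, ‖increment X n ω‖ < K) (n : ℕ) (ω : Ω)
    {e : EuclideanSpace ℝ (Fin d)} (he : ‖e‖ = 1) : |inner ℝ (increment X n ω) e| ≤ K := by
  refine (abs_real_inner_le_norm _ _).trans ?_
  rw [he, mul_one]
  exact (hb n ω).le

theorem integrable_increment [IsFiniteMeasure μ] (hX : ∀ n, Measurable[ℱ n] (X n))
    (hb : ∀ n ω, ‖increment X n ω‖ < K) (n : ℕ) : Integrable (increment X n) μ :=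
  Integrable.of_bound ((measurable_increment hX n).mono (ℱ.le _) le_rfl).aestronglyMeasurable K
    (.of_forall fun ω => (hb n ω).le)

theorem condExp_inner_increment [IsFiniteMeasure μ] (hX : ∀ n, Measurable[ℱ n] (X n))
    (hb : ∀ n ω, ‖increment X n ω‖ < K) (n : ℕ) (e : EuclideanSpace ℝ (Fin d)) :
    ∀ᵐ ω ∂μ, (μ[fun ω => inner ℝ (increment X n ω) e | ℱ n]) ω
      = inner ℝ ((μ[increment X n | ℱ n]) ω) e := by
  have := (innerSL ℝ e).comp_condExp_comm (integrable_increment (μ := μ) hX hb n) (m := ℱ n)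
  filter_upwards [this] with ω hω
  simp only [Function.comp_def, innerSL_apply_apply] at hω
  simp_rw [real_inner_comm]
  exact hω.symm

/-- The first `m` increments all exceed `r` in the direction `ℓ`. -/
def pushEvent (r : ℝ) (ℓ : EuclideanSpace ℝ (Fin d)) (X : ℕ → Ω → (Fin d → ℤ)) (m : ℕ) : Set Ω :=
  {ω | ∀ k < m, r < inner ℝ (increment X k ω) ℓ}

theorem measurableSet_pushEvent (hX : ∀ n, Measurable[ℱ n] (X n)) (m : ℕ) :
    MeasurableSet[ℱ m] (pushEvent r ℓ X m) := by
  have : pushEvent r ℓ X m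
      = ⋂ k ∈ Finset.range m, {ω | r < inner ℝ (increment X k ω) ℓ} := by
    ext ω; simp [pushEvent]
  rw [this]
  refine Finset.measurableSet_biInter _ fun k hk => ?_
  exact ℱ.mono (Finset.mem_range.1 hk) _
    (measurableSet_lt measurable_const (measurable_inner_increment hX k ℓ))

/-- Ellipticity in direction `ℓ` holds at every time, excited or not. Integrated over the `ℱ
m`-measurable event of `m` pushes, it costs one factor `h` for the next push. -/
theorem pow_le_measureReal_pushEvent [IsProbabilityMeasure μ] (hh : 0 < h)
    (hX : IsGERW μ ℱ K h r drift ℓ A X) (m : ℕ) :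
    h ^ m ≤ μ.real (pushEvent r ℓ X m) := by
  induction m with
  | zero => simp [pushEvent]
  | succ m ih =>
    set S := {ω | r < inner ℝ (increment X m ω) ℓ} with hS
    have hSm : MeasurableSet S := ℱ.le (m + 1) _
      (measurableSet_lt measurable_const (measurable_inner_increment hX.adapted m ℓ))
    have hP := measurableSet_pushEvent (r := r) (ℓ := ℓ) hX.adapted m
    have h1 : pushEvent r ℓ X (m + 1) = S ∩ pushEvent r ℓ X m := by
      ext ω
      simp only [pushEvent, hS, Set.mem_inter_iff, Set.mem_ofPred_eq, Nat.lt_succ_iff_lt_or_eq]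
      grind
    have hi : Integrable (S.indicator fun _ => (1 : ℝ)) μ := (integrable_const _).indicator hSm
    have h2 := setIntegral_condExp (ℱ.le m) hi hP
    have h3 : ∫ ω in pushEvent r ℓ X m, S.indicator (fun _ => (1 : ℝ)) ω ∂μ
        = μ.real (pushEvent r ℓ X (m + 1)) := by
      rw [integral_indicator hSm, h1]
      simp [Measure.real, Measure.restrict_apply hSm]
    rw [h3] at h2
    rw [← h2, pow_succ]
    calc h ^ m * h ≤ μ.real (pushEvent r ℓ X m) * h := by gcongr
      _ = ∫ ω in pushEvent r ℓ X m, h ∂μ := by simp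
      _ ≤ _ := by
        refine integral_mono_ae (integrable_const _) integrable_condExp.integrableOn ?_
        exact ae_restrict_of_ae (hX.elliptic_direction m)

/-- A single push has probability at least `h`. Thus the existence of a walk bounds `h`, which `0 <
h` alone does not. -/
theorem ellipticity_le_one [IsProbabilityMeasure μ] (hh : 0 < h)
    (hX : IsGERW μ ℱ K h r drift ℓ A X) : h ≤ 1 := by
  simpa using (pow_le_measureReal_pushEvent hh hX 1).trans measureReal_le_one

theorem inner_walk_sub (X : ℕ → Ω → (Fin d → ℤ)) (n : ℕ) (ω : Ω) (e : EuclideanSpace ℝ (Fin d)) :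
    inner ℝ (latticePoint (X n ω)) e - inner ℝ (latticePoint (X 0 ω)) e
      = ∑ k ∈ Finset.range n, inner ℝ (increment X k ω) e := by
  simp only [increment, inner_sub_left]
  exact (Finset.sum_range_sub (fun k => inner ℝ (latticePoint (X k ω)) e) n).symm

@[simp] theorem latticePoint_zero : latticePoint (0 : Fin d → ℤ) = 0 := by
  ext i; simp [latticePoint]

theorem latticePoint_sub (x y : Fin d → ℤ) :
    latticePoint (x - y) = latticePoint x - latticePoint y := by
  ext i; simp [latticePoint]

theorem inner_walk_eq_sum (hX : ∀ ω, X 0 ω = 0) (n : ℕ) (ω : Ω) (e : EuclideanSpace ℝ (Fin d)) :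
    inner ℝ (latticePoint (X n ω)) e = ∑ k ∈ Finset.range n, inner ℝ (increment X k ω) e := by
  rw [← inner_walk_sub, hX]; simp

end Walk

/-! ### The Lyapunov function and its one-step estimate -/

section Lyapunov

theorem abs_rpow_one_add_sub_one_le {p v : ℝ} (hp0 : 0 ≤ p) (hp1 : p ≤ 1) (hv : |v| ≤ 1 / 2) :
    |(1 + v) ^ p - 1| ≤ |v| := by
  have hv' := abs_le.1 hv
  rcases le_total 0 v with h | h
  · have h1 := rpow_one_add_le_one_add_mul_self (by linarith : -1 ≤ v) hp0 hp1
    have h2 : 1 ≤ (1 + v) ^ p := Real.one_le_rpow (by linarith) hp0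
    rw [abs_of_nonneg (by linarith), abs_of_nonneg h]
    nlinarith
  · have h1 : (1 + v) ^ (1 : ℝ) ≤ (1 + v) ^ p :=
      Real.rpow_le_rpow_of_exponent_ge (by linarith) (by linarith) hp1
    rw [Real.rpow_one] at h1
    have h2 : (1 + v) ^ p ≤ 1 := Real.rpow_le_one (by linarith) (by linarith) hp0
    rw [abs_of_nonpos (by linarith), abs_of_nonpos h]
    linarith

/-- Second-order Taylor expansion through `exp (p * log (1 + v))`: the term `-p v² / 2` of the
logarithm and the term `p² v² / 2` of the exponential combine. The cubic remainders add up to less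
than `5 |v|³`, so the constant `10` is generous. -/
theorem le_rpow_one_add {p v : ℝ} (hp0 : 0 ≤ p) (hp1 : p ≤ 1) (hv : |v| ≤ 1 / 2) :
    1 + p * v - p * (1 - p) / 2 * v ^ 2 - 10 * |v| ^ 3 ≤ (1 + v) ^ p := by
  have hv' := abs_le.1 hv
  set w := Real.log (1 + v) with hw
  set a := |v| with ha
  have ha0 : 0 ≤ a := abs_nonneg v
  have hav : v ^ 2 = a ^ 2 := (sq_abs v).symm
  have hE : |w - v + v ^ 2 / 2| ≤ 2 * a ^ 3 := by
    have h1 := Real.abs_log_sub_add_sum_range_le (x := -v) (by rw [abs_neg]; linarith) 2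
    rw [abs_neg, sub_neg_eq_add] at h1
    have h2 : |v| ^ (2 + 1) / (1 - |v|) ≤ 2 * a ^ 3 := by
      rw [div_le_iff₀ (by linarith)]
      have : 0 ≤ a ^ 3 := by positivity
      rw [← ha]
      norm_num
      nlinarith
    refine le_trans (le_of_eq ?_) (h1.trans h2)
    congr 1
    simp [Finset.sum_range_succ]
    ring
  have hE' := abs_le.1 hE
  have ha2 : a ^ 2 ≤ a / 2 := by nlinarith
  have ha3 : a ^ 3 ≤ a ^ 2 / 2 := by nlinarith [sq_nonneg a]
  have hwv : |w - v| ≤ 3 / 2 * a ^ 2 := by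
    rw [abs_le]; constructor <;> nlinarith
  have hwv' := abs_le.1 hwv
  have hwa : |w| ≤ 7 / 4 * a := by
    have := abs_add_le (w - v) v
    rw [sub_add_cancel] at this
    nlinarith
  have hw2 : v ^ 2 - 3 * a ^ 3 ≤ w ^ 2 := by
    have h1 : -(a * (3 / 2 * a ^ 2)) ≤ v * (w - v) := by
      have := neg_abs_le (v * (w - v))
      rw [abs_mul] at this
      have : |v| * |w - v| ≤ a * (3 / 2 * a ^ 2) := by gcongr
      linarith
    nlinarith [sq_nonneg (w - v)]
  have hz : |p * w| ≤ 7 / 4 * a := by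
    rw [abs_mul, abs_of_nonneg hp0]
    nlinarith [abs_nonneg w]
  have hexp : 1 + p * w + (p * w) ^ 2 / 2 - 2 / 9 * |p * w| ^ 3 ≤ Real.exp (p * w) := by
    have h1 := Real.exp_bound (x := p * w) (by linarith) (n := 3) (by norm_num)
    have h2 := (abs_le.1 h1).1
    simp [Finset.sum_range_succ, Nat.factorial] at h2
    norm_num at h2
    rw [← abs_mul] at h2
    linarith
  have hz3 : |p * w| ^ 3 ≤ (7 / 4 * a) ^ 3 := by gcongr
  have hrp : (1 + v) ^ p = Real.exp (p * w) := by
    rw [Real.rpow_def_of_pos (by linarith), mul_comm]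
  rw [hrp]
  have hA3 : 0 ≤ a ^ 3 := by positivity
  have e1 : p * (v - v ^ 2 / 2 - 2 * a ^ 3) ≤ p * w := by gcongr; linarith
  have e2 : p ^ 2 * (v ^ 2 - 3 * a ^ 3) ≤ p ^ 2 * w ^ 2 := by gcongr
  have e3 : p * a ^ 3 ≤ a ^ 3 := by nlinarith
  have e4 : p ^ 2 * a ^ 3 ≤ a ^ 3 := by nlinarith
  nlinarith

theorem exp_neg_le_of_abs_le_one {z : ℝ} (hz : |z| ≤ 1) : Real.exp (-z) ≤ 1 - z + z ^ 2 := by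
  have := (abs_le.1 (Real.abs_exp_sub_one_sub_id_le (x := -z) (by rwa [abs_neg]))).2
  nlinarith

/-- To be read with `s = ‖x‖² + L`, `q = ⟨x, D⟩`, `N = ‖D‖²`. The bound `exp (-z) ≤ 1 - z + z²`
meets the expansion of `(1 + v) ^ p` at `v = (2q + N) / s`. The condition `θ * s ^ p ≤ ε` reduces
`z²` to `θ s ^ p * ε v²`. Since `p ≥ 1/4`, errors can be written as multiples of `p / s`, whence the
factors `40` and `4`. -/
theorem exp_neg_mul_rpow_sub_le {K p θ ε s a q N : ℝ} (hK : 0 < K) (hp0 : 1 / 4 ≤ p)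
    (hp1 : p ≤ 1 / 2) (ha1 : 1 ≤ a) (has : s = a ^ 2) (hKa : K ^ 2 ≤ a) (hKa' : 2 * (2 * K + 1) ≤ a)
    (hq : |q| ≤ a * K) (hN0 : 0 ≤ N) (hN : N ≤ K ^ 2) (hθ : 0 ≤ θ) (hε : ε ≤ 1)
    (hθs : θ * s ^ p ≤ ε) :
    Real.exp (-(θ * ((s + (2 * q + N)) ^ p - s ^ p))) ≤
      1 - θ * p * s ^ (p - 1) * (2 * q + N - 2 * (1 - p) * (q ^ 2 / s)
        - (4 * K ^ 3 + K ^ 4 + 40 * (2 * K + 1) ^ 3) / a - 4 * ε * (2 * K + 1) ^ 2) := by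
  have ha0 : 0 < a := by linarith
  have hs : 0 < s := by rw [has]; positivity
  set u := 2 * q + N with hu
  set v := u / s with hv
  have hq' := abs_le.1 hq
  have huabs : |u| ≤ (2 * K + 1) * a := by
    rw [abs_le]; constructor <;> nlinarith
  have hvabs : |v| ≤ (2 * K + 1) / a := by
    rw [hv, abs_div, abs_of_pos hs, div_le_div_iff₀ hs ha0, has]
    nlinarith
  have hvhalf : |v| ≤ 1 / 2 := by
    refine hvabs.trans ?_
    rw [div_le_iff₀ ha0]; linarith
  have hus : s + u = s * (1 + v) := by rw [hv]; field_simp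
  have hP : 0 < s ^ p := Real.rpow_pos_of_pos hs p
  have hsp : s ^ (p - 1) = s ^ p / s := by rw [Real.rpow_sub hs, Real.rpow_one]
  have hv1 : 0 ≤ 1 + v := by linarith [(abs_le.1 hvhalf).1]
  rw [hus, Real.mul_rpow hs.le hv1, hsp]
  set P := s ^ p with hPdef
  have hT : 0 ≤ θ * P := by positivity
  have hε0 : 0 ≤ ε := hT.trans hθs
  set y := (1 + v) ^ p - 1 with hy
  have hyabs : |y| ≤ |v| := abs_rpow_one_add_sub_one_le (by linarith) (by linarith) hvhalf
  have hylow : p * v - p * (1 - p) / 2 * v ^ 2 - 10 * |v| ^ 3 ≤ y := by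
    have := le_rpow_one_add (by linarith : (0 : ℝ) ≤ p) (by linarith) hvhalf
    linarith
  have hz : θ * (P * (1 + v) ^ p - P) = θ * P * y := by rw [hy]; ring
  rw [hz]
  have hz1 : |θ * P * y| ≤ 1 := by
    rw [abs_mul, abs_of_nonneg hT]
    nlinarith [abs_nonneg y]
  have h1 := exp_neg_le_of_abs_le_one hz1
  have hy2 : y ^ 2 ≤ v ^ 2 := sq_le_sq.2 hyabs
  have h2 : (θ * P * y) ^ 2 ≤ θ * P * (ε * v ^ 2) := by
    have : (θ * P * y) ^ 2 = θ * P * (θ * P * y ^ 2) := by ring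
    rw [this]
    gcongr
  have hv2 : v ^ 2 ≤ (2 * K + 1) ^ 2 / s := by
    have : v ^ 2 ≤ ((2 * K + 1) / a) ^ 2 := by
      rw [← sq_abs v]; gcongr
    rwa [div_pow _ a, ← has] at this
  have hv3 : |v| ^ 3 ≤ (2 * K + 1) ^ 3 / (a * s) := by
    have : |v| ^ 3 ≤ ((2 * K + 1) / a) ^ 3 := by gcongr
    rw [div_pow] at this
    rwa [has, show a * a ^ 2 = a ^ 3 by ring]
  -- The part `4 q²` must be kept exactly because it competes with `N`; the other terms are smaller
  -- by a factor of order `a`.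
  have hu2 : u ^ 2 ≤ 4 * q ^ 2 + (4 * K ^ 3 + K ^ 4) * a := by
    have e1 : q * N ≤ a * K * K ^ 2 := by
      calc q * N ≤ |q| * N := by gcongr; exact le_abs_self q
        _ ≤ _ := by gcongr
    have e2 : N ^ 2 ≤ (K ^ 2) ^ 2 := by gcongr
    have e3 : K ^ 4 ≤ K ^ 4 * a := le_mul_of_one_le_right (by positivity) ha1
    rw [hu]; nlinarith
  have hmain : p / s * (u - 2 * (1 - p) * (q ^ 2 / s)
        - (4 * K ^ 3 + K ^ 4 + 40 * (2 * K + 1) ^ 3) / a - 4 * ε * (2 * K + 1) ^ 2)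
      ≤ p * v - p * (1 - p) / 2 * v ^ 2 - 10 * |v| ^ 3 - ε * v ^ 2 := by
    have f1 : p * v = p / s * u := by rw [hv]; ring
    have f2 : p * (1 - p) / 2 * v ^ 2
        ≤ p / s * (2 * (1 - p) * (q ^ 2 / s) + (4 * K ^ 3 + K ^ 4) / a) := by
      have : v ^ 2 ≤ (4 * q ^ 2 + (4 * K ^ 3 + K ^ 4) * a) / s ^ 2 := by
        rw [hv, div_pow]; gcongr
      have hp2 : 0 ≤ p * (1 - p) / 2 := by
        have : 0 ≤ 1 - p := by linarith
        positivity
      calc p * (1 - p) / 2 * v ^ 2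
          ≤ p * (1 - p) / 2 * ((4 * q ^ 2 + (4 * K ^ 3 + K ^ 4) * a) / s ^ 2) := by gcongr
        _ = p / s * (2 * (1 - p) * (q ^ 2 / s) + (1 - p) / 2 * ((4 * K ^ 3 + K ^ 4) / a)) := by
            rw [has]; field_simp; ring
        _ ≤ p / s * (2 * (1 - p) * (q ^ 2 / s) + 1 * ((4 * K ^ 3 + K ^ 4) / a)) := by
            have : (1 - p) / 2 ≤ 1 := by linarith
            gcongr
        _ = _ := by rw [one_mul]
    have f3 : 10 * |v| ^ 3 ≤ p / s * (40 * (2 * K + 1) ^ 3 / a) := by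
      calc 10 * |v| ^ 3 ≤ 10 * ((2 * K + 1) ^ 3 / (a * s)) := by gcongr
        _ = (1 / 4) / s * (40 * (2 * K + 1) ^ 3 / a) := by field_simp; norm_num
        _ ≤ _ := by gcongr
    have f4 : ε * v ^ 2 ≤ p / s * (4 * ε * (2 * K + 1) ^ 2) := by
      calc ε * v ^ 2 ≤ ε * ((2 * K + 1) ^ 2 / s) := by gcongr
        _ = (1 / 4) / s * (4 * ε * (2 * K + 1) ^ 2) := by field_simp
        _ ≤ _ := by gcongr
    have f5 : p / s * ((4 * K ^ 3 + K ^ 4 + 40 * (2 * K + 1) ^ 3) / a)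
        = p / s * ((4 * K ^ 3 + K ^ 4) / a) + p / s * (40 * (2 * K + 1) ^ 3 / a) := by ring
    rw [f1, mul_sub, mul_sub, mul_sub, f5]
    rw [mul_add] at f2
    linarith
  have h3 : θ * P * (p / s * (u - 2 * (1 - p) * (q ^ 2 / s)
        - (4 * K ^ 3 + K ^ 4 + 40 * (2 * K + 1) ^ 3) / a - 4 * ε * (2 * K + 1) ^ 2))
      ≤ θ * P * (y - ε * v ^ 2) := by
    refine mul_le_mul_of_nonneg_left (hmain.trans ?_) hT
    linarith
  have h4 : θ * p * (P / s) = θ * P * (p / s) := by ring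
  rw [h4, mul_assoc (θ * P)]
  linarith [mul_sub (θ * P) y (ε * v ^ 2)]

theorem abs_rpow_sub_rpow_le {K p s a q N : ℝ} (hK : 0 < K) (hp0 : 0 ≤ p)
    (hp1 : p ≤ 1) (ha1 : 1 ≤ a) (has : s = a ^ 2) (hKa : K ^ 2 ≤ a) (hKa' : 2 * (2 * K + 1) ≤ a)
    (hq : |q| ≤ a * K) (hN0 : 0 ≤ N) (hN : N ≤ K ^ 2) :
    |(s + (2 * q + N)) ^ p - s ^ p| ≤ (2 * K + 1) * s ^ (p - 1 / 2) := by
  have ha0 : 0 < a := by linarith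
  have hs : 0 < s := by rw [has]; positivity
  set u := 2 * q + N with hu
  set v := u / s with hv
  have hq' := abs_le.1 hq
  have huabs : |u| ≤ (2 * K + 1) * a := by
    rw [abs_le]; constructor <;> nlinarith
  have hvabs : |v| ≤ (2 * K + 1) / a := by
    rw [hv, abs_div, abs_of_pos hs, div_le_div_iff₀ hs ha0, has]
    nlinarith
  have hvhalf : |v| ≤ 1 / 2 := by
    refine hvabs.trans ?_
    rw [div_le_iff₀ ha0]; linarith
  have hus : s + u = s * (1 + v) := by rw [hv]; field_simp
  have hv1 : 0 ≤ 1 + v := by linarith [(abs_le.1 hvhalf).1]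
  have hsa : s ^ (1 / 2 : ℝ) = a := by
    rw [has, ← Real.sqrt_eq_rpow, Real.sqrt_sq ha0.le]
  rw [hus, Real.mul_rpow hs.le hv1, Real.rpow_sub hs, hsa]
  have h1 := (abs_rpow_one_add_sub_one_le hp0 hp1 hvhalf).trans hvabs
  have hP : 0 < s ^ p := Real.rpow_pos_of_pos hs p
  calc |s ^ p * (1 + v) ^ p - s ^ p| = s ^ p * |(1 + v) ^ p - 1| := by
        rw [← abs_of_pos hP, ← abs_mul, abs_of_pos hP]; ring_nf
    _ ≤ s ^ p * ((2 * K + 1) / a) := by gcongr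
    _ = _ := by ring

/-- The Lyapunov function `(‖x‖ ^ 2 + L) ^ p`. -/
noncomputable def lyapunov {d : ℕ} (p L : ℝ) (x : EuclideanSpace ℝ (Fin d)) : ℝ :=
  (‖x‖ ^ 2 + L) ^ p

/-- Parameters for which `lyapunov p L` is a quantitative submartingale along steps without drift,
in exponential form. -/
structure IsLyapunov (d : ℕ) (K h r p L ε : ℝ) : Prop where
  quarter_le : 1 / 4 ≤ p
  lt_half : p < 1 / 2
  one_le : 1 ≤ L
  pos : 0 < ε
  step : ∀ x D e : EuclideanSpace ℝ (Fin d), ‖e‖ = 1 → inner ℝ x e = 0 → ‖D‖ ≤ K → ∀ θ : ℝ,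
    0 ≤ θ → θ * (‖x‖ ^ 2 + L) ^ p ≤ ε →
    Real.exp (-(θ * (lyapunov p L (x + D) - lyapunov p L x))) ≤
      1 - θ * p * (‖x‖ ^ 2 + L) ^ (p - 1) *
        (2 * inner ℝ x D + (if r < inner ℝ D e then r ^ 2 else 0) - 3 / 4 * (h * r ^ 2))
  lipschitz : ∀ x D : EuclideanSpace ℝ (Fin d), ‖D‖ ≤ K →
    |lyapunov p L (x + D) - lyapunov p L x| ≤ (2 * K + 1) * (‖x‖ ^ 2 + L) ^ (p - 1 / 2)

/-- Removing from `D` its component along `e` does not change its inner product with `x`, so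
Cauchy–Schwarz applies to what is left, and Pythagoras gives the sum. -/
theorem sq_inner_div_add_sq_inner_le {E : Type*} [NormedAddCommGroup E] [InnerProductSpace ℝ E]
    {x D e : E} (he : ‖e‖ = 1) (hxe : inner ℝ x e = 0) {s : ℝ} (hs : 0 < s) (hxs : ‖x‖ ^ 2 ≤ s) :
    (inner ℝ x D) ^ 2 / s + (inner ℝ D e) ^ 2 ≤ ‖D‖ ^ 2 := by
  set c : ℝ := inner ℝ D e with hc
  have h1 : inner ℝ x (D - c • e) = inner ℝ x D := by
    rw [inner_sub_right, inner_smul_right, hxe]; ring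
  have h2 : ‖D - c • e‖ ^ 2 = ‖D‖ ^ 2 - c ^ 2 := by
    rw [norm_sub_sq_real, inner_smul_right, norm_smul, he, mul_one, Real.norm_eq_abs, sq_abs, ← hc]
    ring
  have h3 : (inner ℝ x D) ^ 2 ≤ ‖x‖ ^ 2 * ‖D - c • e‖ ^ 2 := by
    rw [← h1, ← sq_abs, ← mul_pow]
    gcongr
    exact abs_real_inner_le_norm _ _
  have h4 : (inner ℝ x D) ^ 2 / s ≤ ‖D - c • e‖ ^ 2 := by
    rw [div_le_iff₀ hs, mul_comm]
    exact h3.trans (by gcongr)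
  linarith

/-- For `p = (1 - g) / 2` the second-order coefficient is `2 (1 - p) = 1 + g`, so the quadratic part
is at least `⟨D, e⟩² - g K²`. The three errors, namely `g K²`, the Taylor remainder `C / a` and the
term with `ε`, are each made at most `h r² / 4`. Ellipticity contributes `h r²` on average, so `h r²
/ 4` remains. -/
theorem exists_isLyapunov (d : ℕ) {K h r : ℝ} (hK : 0 < K) (hh : 0 < h) (hr : 0 < r) :
    ∃ p L ε, IsLyapunov d K h r p L ε := by
  set q := h * r ^ 2 with hq
  have hq0 : 0 < q := by positivity
  set g := min (1 / 2) (q / (4 * K ^ 2)) with hg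
  have hg0 : 0 < g := by positivity
  have hg1 : g ≤ 1 / 2 := min_le_left _ _
  have hgK : g * K ^ 2 ≤ q / 4 := by
    calc g * K ^ 2 ≤ q / (4 * K ^ 2) * K ^ 2 := by gcongr; exact min_le_right _ _
      _ = q / 4 := by field_simp
  set ε := min 1 (q / (16 * (2 * K + 1) ^ 2)) with hε
  have hε0 : 0 < ε := by positivity
  have hεq : 4 * ε * (2 * K + 1) ^ 2 ≤ q / 4 := by
    calc 4 * ε * (2 * K + 1) ^ 2 ≤ 4 * (q / (16 * (2 * K + 1) ^ 2)) * (2 * K + 1) ^ 2 := by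
          gcongr; exact min_le_right _ _
      _ = q / 4 := by field_simp; norm_num
  set C := 4 * K ^ 3 + K ^ 4 + 40 * (2 * K + 1) ^ 3 with hC
  have hC0 : 0 < C := by positivity
  -- The choice `L = a₀ ^ 2` puts `√(‖x‖² + L)` above every threshold at once, for all `x`.
  set a₀ := 1 + K ^ 2 + 2 * (2 * K + 1) + 4 * C / q with ha₀
  have hCq : 0 < 4 * C / q := by positivity
  have hfacts : ∀ x : EuclideanSpace ℝ (Fin d), ∃ a, 1 ≤ a ∧ ‖x‖ ^ 2 + a₀ ^ 2 = a ^ 2 ∧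
      K ^ 2 ≤ a ∧ 2 * (2 * K + 1) ≤ a ∧ 4 * C / q ≤ a ∧ ‖x‖ ≤ a := by
    intro x
    have h0 : a₀ ≤ √(‖x‖ ^ 2 + a₀ ^ 2) := Real.le_sqrt_of_sq_le (by linarith [sq_nonneg ‖x‖])
    have hK2 : 0 < K ^ 2 := by positivity
    exact ⟨√(‖x‖ ^ 2 + a₀ ^ 2), by linarith, (Real.sq_sqrt (by positivity)).symm, by linarith,
      by linarith, by linarith, Real.le_sqrt_of_sq_le (by linarith [sq_nonneg a₀])⟩
  have hexpand : ∀ x D : EuclideanSpace ℝ (Fin d),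
      ‖x + D‖ ^ 2 + a₀ ^ 2 = ‖x‖ ^ 2 + a₀ ^ 2 + (2 * inner ℝ x D + ‖D‖ ^ 2) := fun x D => by
    rw [norm_add_sq_real]; ring
  refine ⟨(1 - g) / 2, a₀ ^ 2, ε, by linarith, by linarith, ?_, hε0, ?_, ?_⟩
  · have h1 : 0 < K ^ 2 := by positivity
    exact one_le_pow₀ (by linarith)
  · intro x D e he hxe hD θ hθ hθs
    obtain ⟨a, ha1, has, haK, haK', haC, hxa⟩ := hfacts x
    have hs : 0 < ‖x‖ ^ 2 + a₀ ^ 2 := by rw [has]; positivity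
    have hqa : |inner ℝ x D| ≤ a * K := (abs_real_inner_le_norm _ _).trans (by gcongr)
    have h1 := exp_neg_mul_rpow_sub_le hK (p := (1 - g) / 2) (by linarith) (by linarith) ha1 has
      haK haK' hqa (sq_nonneg ‖D‖) (by gcongr) hθ (min_le_left _ _) hθs
    rw [lyapunov, lyapunov, hexpand]
    refine h1.trans ?_
    have h2 := sq_inner_div_add_sq_inner_le (D := D) he hxe hs (le_add_of_nonneg_right (sq_nonneg a₀))
    have h3 : (inner ℝ x D) ^ 2 / (‖x‖ ^ 2 + a₀ ^ 2) ≤ K ^ 2 := by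
      have h31 : ‖D‖ ^ 2 ≤ K ^ 2 := by gcongr
      have h32 : 0 ≤ (inner ℝ D e) ^ 2 := sq_nonneg _
      linarith
    have h4 : (if r < inner ℝ D e then r ^ 2 else 0) ≤ (inner ℝ D e) ^ 2 := by
      split_ifs with h
      · gcongr
      · positivity
    have h5 : C / a ≤ q / 4 := by
      rw [div_le_iff₀ (by linarith)]
      rw [div_le_iff₀ hq0] at haC
      linarith
    have h6 : g * ((inner ℝ x D) ^ 2 / (‖x‖ ^ 2 + a₀ ^ 2)) ≤ g * K ^ 2 := by gcongr
    have h7 : 2 * (1 - (1 - g) / 2) * ((inner ℝ x D) ^ 2 / (‖x‖ ^ 2 + a₀ ^ 2))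
        = (inner ℝ x D) ^ 2 / (‖x‖ ^ 2 + a₀ ^ 2)
          + g * ((inner ℝ x D) ^ 2 / (‖x‖ ^ 2 + a₀ ^ 2)) := by ring
    have h8 : 0 ≤ θ * ((1 - g) / 2) * (‖x‖ ^ 2 + a₀ ^ 2) ^ ((1 - g) / 2 - 1) := by
      have : 0 ≤ (1 - g) / 2 := by linarith
      positivity
    refine sub_le_sub_left (mul_le_mul_of_nonneg_left ?_ h8) 1
    rw [h7]
    linarith
  · intro x D hD
    obtain ⟨a, ha1, has, haK, haK', haC, hxa⟩ := hfacts x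
    have hqa : |inner ℝ x D| ≤ a * K := (abs_real_inner_le_norm _ _).trans (by gcongr)
    rw [lyapunov, lyapunov, hexpand]
    exact abs_rpow_sub_rpow_le hK (by linarith) (by linarith) ha1 has haK haK' hqa
      (sq_nonneg ‖D‖) (by gcongr)

theorem exists_norm_eq_one_inner_eq_zero {d : ℕ} (hd : 2 ≤ d) (x : EuclideanSpace ℝ (Fin d)) :
    ∃ e : EuclideanSpace ℝ (Fin d), ‖e‖ = 1 ∧ inner ℝ x e = 0 := by
  have h1 : (ℝ ∙ x)ᗮ ≠ ⊥ := by
    intro h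
    have h2 := Submodule.finrank_add_finrank_orthogonal (ℝ ∙ x)
    rw [h, finrank_bot, finrank_euclideanSpace, Fintype.card_fin] at h2
    have h3 := finrank_span_le_card (R := ℝ) ({x} : Set (EuclideanSpace ℝ (Fin d)))
    simp at h3
    omega
  obtain ⟨y, hy, hy0⟩ := Submodule.exists_mem_ne_zero_of_ne_bot h1
  refine ⟨(‖y‖⁻¹ : ℝ) • y, by simp [norm_smul, hy0], ?_⟩
  rw [inner_smul_right, Submodule.mem_orthogonal_singleton_iff_inner_right.1 hy, mul_zero]

end Lyapunov

/-! ### Supermartingales for the displacement and for the visits to a site -/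

theorem condExp_affine {Ω : Type*} {m m0 : MeasurableSpace Ω} {μ : Measure Ω} [IsFiniteMeasure μ]
    (hm : m ≤ m0) {U V : Ω → ℝ} (hU : Integrable U μ) (hV : Integrable V μ) (a b c : ℝ) :
    ∀ᵐ ω ∂μ, (μ[fun ω => a + b * U ω + c * V ω | m]) ω
      = a + b * (μ[U | m]) ω + c * (μ[V | m]) ω := by
  have h1 : (fun ω => a + b * U ω + c * V ω) = ((fun _ => a) + b • U) + c • V := by
    ext ω; simp
  rw [h1]
  filter_upwards [condExp_add ((integrable_const a).add (hU.smul b)) (hV.smul c) m,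
    condExp_add (integrable_const a) (hU.smul b) m, condExp_smul b U m (μ := μ),
    condExp_smul c V m (μ := μ)] with ω h1 h2 h3 h4
  rw [h1, Pi.add_apply, h2, Pi.add_apply, h3, h4, condExp_const hm a]
  simp

section Walk

variable {d : ℕ} {Ω : Type u} {mΩ : MeasurableSpace Ω} {μ : Measure Ω} [IsProbabilityMeasure μ]
  {ℱ : Filtration ℕ mΩ}
  {K h r : ℝ} {drift : ℕ → ℝ} {ℓ : EuclideanSpace ℝ (Fin d)} {A : Set (Fin d → ℤ)}
  {X : ℕ → Ω → (Fin d → ℤ)}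

/-- The indicator of excitation at time `n`. -/
noncomputable def excitation (A : Set (Fin d → ℤ)) (X : ℕ → Ω → (Fin d → ℤ)) (n : ℕ) (ω : Ω) : ℝ :=
  open Classical in if IsExcitedAt A X n ω then 1 else 0

theorem measurable_excitation (hX : ∀ n, Measurable[ℱ n] (X n)) (n : ℕ) :
    Measurable[ℱ n] (excitation A X n) := by
  classical
  exact Measurable.ite (measurableSet_isExcitedAt hX n) measurable_const measurable_const

theorem excitation_nonneg (A : Set (Fin d → ℤ)) (X : ℕ → Ω → (Fin d → ℤ)) (n : ℕ) (ω : Ω) :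
    0 ≤ excitation A X n ω := by
  unfold excitation; split_ifs <;> norm_num

theorem excitation_le_one (A : Set (Fin d → ℤ)) (X : ℕ → Ω → (Fin d → ℤ)) (n : ℕ) (ω : Ω) :
    excitation A X n ω ≤ 1 := by
  unfold excitation; split_ifs <;> norm_num

/-- Exponential bound for the displacement, up to the contribution of the excited times. -/
theorem measureReal_displacement_le (hK : 0 < K) (hX : IsGERW μ ℱ K h r drift ℓ A X)
    {e : EuclideanSpace ℝ (Fin d)} (he : ‖e‖ = 1) {t : ℝ} (ht : 0 ≤ t) (n : ℕ) (a : ℝ) :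
    μ.real {ω | a ≤ t * inner ℝ (latticePoint (X n ω)) e - n * (t ^ 2 * K ^ 2 / 2)
      - t * K * ∑ k ∈ Finset.range n, excitation A X k ω} ≤ Real.exp (-a) := by
  set ξ : ℕ → Ω → ℝ := fun k ω =>
    t * inner ℝ (increment X k ω) e - t ^ 2 * K ^ 2 / 2 - t * K * excitation A X k ω with hξ
  have hUm : ∀ k, Measurable[ℱ (k + 1)] fun ω => inner ℝ (increment X k ω) e := fun k =>
    measurable_inner_increment hX.adapted k e
  have hUb : ∀ k ω, inner ℝ (increment X k ω) e ≤ K := fun k ω =>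
    (le_abs_self _).trans (abs_inner_increment_le hX.bounded k ω he)
  have hξm : ∀ k, Measurable[ℱ (k + 1)] (ξ k) := fun k =>
    (((hUm k).const_mul t).sub_const _).sub
      (((measurable_excitation hX.adapted k).mono (ℱ.mono k.le_succ) le_rfl).const_mul _)
  have hξb : ∀ k ω, ξ k ω ≤ t * K := fun k ω => by
    have h1 : t * inner ℝ (increment X k ω) e ≤ t * K := by gcongr; exact hUb k ω
    have h2 : 0 ≤ t * K * excitation A X k ω := by
      have := excitation_nonneg A X k ω
      positivity
    simp only [hξ]
    nlinarith [sq_nonneg (t * K)]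
  have hsum : ∀ ω, ∑ k ∈ Finset.range n, ξ k ω
      = t * inner ℝ (latticePoint (X n ω)) e - n * (t ^ 2 * K ^ 2 / 2)
      - t * K * ∑ k ∈ Finset.range n, excitation A X k ω := fun ω => by
    simp only [hξ, Finset.sum_sub_distrib, inner_walk_eq_sum hX.start, Finset.mul_sum]
    simp
  simp_rw [← hsum]
  refine measureReal_le_exp_neg hξm (fun k => ⟨t * K, hξb k⟩) (fun k => ?_) n a
  have hi : Integrable (fun ω => Real.exp (ξ k ω)) μ :=
    integrable_exp_of_le ((hξm k).mono (ℱ.le _) le_rfl) _ (hξb k)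
  have hexc := measurableSet_isExcitedAt (A := A) hX.adapted k
  have h1 : ∀ᵐ ω ∂μ, ω ∈ {ω | IsExcitedAt A X k ω} →
      (μ[fun ω => Real.exp (ξ k ω) | ℱ k]) ω ≤ 1 := by
    refine condExp_le_one_on (ℱ.le k) hexc hi fun ω hω => ?_
    have hω' : IsExcitedAt A X k ω := hω
    rw [Real.exp_le_one_iff]
    have h2 : t * inner ℝ (increment X k ω) e ≤ t * K := by gcongr; exact hUb k ω
    simp only [hξ, excitation, if_pos hω']
    nlinarith [sq_nonneg (t * K)]
  -- The sign is reversed because `condExp_exp_le_one` bounds the exponential of `-t * U`.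
  set U : Ω → ℝ := fun ω => inner ℝ (increment X k ω) (-e) with hU
  have hU' : Measurable U := (measurable_inner_increment hX.adapted k (-e)).mono (ℱ.le _) le_rfl
  have hUabs : ∀ ω, |U ω| ≤ K := fun ω =>
    abs_inner_increment_le hX.bounded k ω (by rwa [norm_neg])
  have h2 : ∀ᵐ ω ∂μ, ω ∈ {ω | IsExcitedAt A X k ω}ᶜ →
      (μ[fun ω => Real.exp (ξ k ω) | ℱ k]) ω
        ≤ (μ[fun ω => Real.exp (-t * U ω - t ^ 2 * K ^ 2 / 2) | ℱ k]) ω := by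
    refine condExp_le_condExp_on (ℱ.le k) hexc.compl hi
      (integrable_exp_of_le (by fun_prop) (t * K) fun ω => ?_) fun ω hω => ?_
    · have := (abs_le.1 (hUabs ω)).1
      have : t * (-U ω) ≤ t * K := by gcongr; linarith
      nlinarith [sq_nonneg (t * K)]
    · have hω' : ¬ IsExcitedAt A X k ω := hω
      rw [Real.exp_le_exp]
      simp [hξ, excitation, if_neg hω', hU, inner_neg_right]
  have h3 := condExp_exp_le_one (μ := μ) (ℱ.le k) hU' hK ht hUabs
    (s := {ω | IsExcitedAt A X k ω}ᶜ) (by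
      filter_upwards [condExp_inner_increment hX.adapted hX.bounded k (-e), hX.drift_eq_zero k]
        with ω h1 h2 hω
      rw [h1, h2 hω, inner_zero_left])
  filter_upwards [h1, h2, h3] with ω h1 h2 h3
  by_cases hω : ω ∈ {ω | IsExcitedAt A X k ω}
  · exact h1 hω
  · exact (h2 hω).trans (h3 hω)

/-- The regularized squared distance between two lattice points. -/
noncomputable def regDist (L : ℝ) (y z : Fin d → ℤ) : ℝ :=
  ‖latticePoint z - latticePoint y‖ ^ 2 + L

theorem one_le_regDist {L : ℝ} (hL : 1 ≤ L) (y z : Fin d → ℤ) : 1 ≤ regDist L y z := by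
  unfold regDist; nlinarith [sq_nonneg ‖latticePoint z - latticePoint y‖]

/-- The gain of the Lyapunov function at each visit of its centre. -/
noncomputable def visitGain (h r p L : ℝ) : ℝ := p * L ^ (p - 1) * (h * r ^ 2 / 4)

/-- One step of the exponent of the supermartingale that controls the visits to `y`. -/
noncomputable def visitStep (K h r p L θ S : ℝ) (A : Set (Fin d → ℤ)) (X : ℕ → Ω → (Fin d → ℤ))
    (y : Fin d → ℤ) (k : ℕ) (ω : Ω) : ℝ :=
  if regDist L y (X k ω) ≤ S then
    θ * (visitGain h r p L * (if X k ω = y then 1 else 0)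
      - (regDist L y (X (k + 1) ω) ^ p - regDist L y (X k ω) ^ p)
      - (2 * K + 1 + h * r ^ 2) * (excitation A X k ω * regDist L y (X k ω) ^ (p - 1 / 2)))
  else 0

variable {p L ε θ S : ℝ}

theorem lyapunov_sub_eq_regDist (y z : Fin d → ℤ) :
    lyapunov p L (latticePoint z - latticePoint y) = regDist L y z ^ p := rfl

theorem regDist_succ (y : Fin d → ℤ) (k : ℕ) (ω : Ω) :
    regDist L y (X (k + 1) ω) ^ p
      = lyapunov p L (latticePoint (X k ω) - latticePoint y + increment X k ω) := by
  rw [← lyapunov_sub_eq_regDist]; congr 1; unfold increment; abel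

theorem visitGain_le (hh : 0 < h) (hL : IsLyapunov d K h r p L ε) :
    visitGain h r p L ≤ h * r ^ 2 * L ^ (p - 1 / 2) := by
  have h1 : L ^ (p - 1) ≤ L ^ (p - 1 / 2) :=
    Real.rpow_le_rpow_of_exponent_le hL.one_le (by linarith)
  have h2 := hL.quarter_le
  have h3 := hL.lt_half
  have h0 : 0 ≤ L ^ (p - 1) := Real.rpow_nonneg (by linarith [hL.one_le]) _
  unfold visitGain
  calc p * L ^ (p - 1) * (h * r ^ 2 / 4) ≤ 1 * L ^ (p - 1 / 2) * (h * r ^ 2) := by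
        have h4 : 0 ≤ h * r ^ 2 := by positivity
        have h5 : h * r ^ 2 / 4 ≤ h * r ^ 2 := by linarith
        have h6 : p ≤ 1 := by linarith
        have h7 : 0 < L := by linarith [hL.one_le]
        gcongr
    _ = _ := by ring

theorem visitStep_le (hK : 0 < K) (hh : 0 < h) (hL : IsLyapunov d K h r p L ε)
    (hb : ∀ n ω, ‖increment X n ω‖ < K) (hθ : 0 ≤ θ) (y : Fin d → ℤ) (k : ℕ) (ω : Ω) :
    visitStep K h r p L θ S A X y k ω ≤ θ * (visitGain h r p L + (2 * K + 1)) := by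
  have hp := hL.quarter_le
  have hL1 := hL.one_le
  have hg : 0 ≤ visitGain h r p L := by unfold visitGain; positivity
  by_cases h1 : regDist L y (X k ω) ≤ S
  swap
  · rw [visitStep, if_neg h1]
    positivity
  rw [visitStep, if_pos h1]
  have h2 : |regDist L y (X (k + 1) ω) ^ p - regDist L y (X k ω) ^ p| ≤ 2 * K + 1 := by
    rw [regDist_succ]
    refine (hL.lipschitz _ _ (hb k ω).le).trans ?_
    have : regDist L y (X k ω) ^ (p - 1 / 2) ≤ 1 :=
      Real.rpow_le_one_of_one_le_of_nonpos (one_le_regDist hL1 _ _) (by linarith [hL.lt_half])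
    exact mul_le_of_le_one_right (by positivity) this
  have h3 : 0 ≤ (2 * K + 1 + h * r ^ 2)
      * (excitation A X k ω * regDist L y (X k ω) ^ (p - 1 / 2)) := by
    have := excitation_nonneg A X k ω
    have := one_le_regDist hL1 y (X k ω)
    positivity
  have h4 : visitGain h r p L * (if X k ω = y then 1 else 0) ≤ visitGain h r p L := by
    split_ifs <;> simp [hg]
  gcongr
  linarith [(abs_le.1 h2).1]

theorem measurable_visitStep (hX : ∀ n, Measurable[ℱ n] (X n)) (y : Fin d → ℤ) (k : ℕ) :
    Measurable[ℱ (k + 1)] (visitStep K h r p L θ S A X y k) := by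
  have h1 := fun f : (Fin d → ℤ) → ℝ => measurable_comp_walk hX k.le_succ f
  have h2 := measurable_comp_walk hX le_rfl (k := k + 1) fun z => regDist L y z ^ p
  have h3 := (measurable_excitation (A := A) hX k).mono (ℱ.mono k.le_succ) le_rfl
  unfold visitStep
  refine Measurable.ite (measurableSet_walk_mem hX k.le_succ {z | regDist L y z ≤ S}) ?_
    measurable_const
  exact ((((h1 fun z => if z = y then 1 else 0).const_mul _).sub
    (h2.sub (h1 fun z => regDist L y z ^ p))).sub
    ((h3.mul (h1 fun z => regDist L y z ^ (p - 1 / 2))).const_mul _)).const_mul _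

/-- At an excited time nothing is known about the mean beyond a lower bound in one direction, so the
estimate is pathwise. In the penalty, `2 * K + 1` pays for the change of the Lyapunov function and
`h * r ^ 2` for the visit gain in case the walk is at `y`. -/
theorem visitStep_nonpos_of_isExcitedAt (hh : 0 < h) (hL : IsLyapunov d K h r p L ε)
    (hb : ∀ n ω, ‖increment X n ω‖ < K) (hθ : 0 ≤ θ) (y : Fin d → ℤ) {k : ℕ} {ω : Ω}
    (hω : IsExcitedAt A X k ω) : visitStep K h r p L θ S A X y k ω ≤ 0 := by
  unfold visitStep
  split_ifs with h1 h2
  · refine mul_nonpos_of_nonneg_of_nonpos hθ ?_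
    have h3 := (abs_le.1 (hL.lipschitz _ _ (hb k ω).le :
      |lyapunov p L (latticePoint (X k ω) - latticePoint y + increment X k ω) - _| ≤ _)).1
    rw [← regDist_succ, lyapunov_sub_eq_regDist] at h3
    have h4 := visitGain_le hh hL
    have h5 : regDist L y (X k ω) = L := by simp [regDist, h2]
    have h6 : ‖latticePoint (X k ω) - latticePoint y‖ ^ 2 + L = L := h5
    rw [h6] at h3
    simp only [excitation, if_pos hω, h5] at h3 ⊢
    linarith
  · refine mul_nonpos_of_nonneg_of_nonpos hθ ?_
    have h3 := (abs_le.1 (hL.lipschitz _ _ (hb k ω).le :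
      |lyapunov p L (latticePoint (X k ω) - latticePoint y + increment X k ω) - _| ≤ _)).1
    rw [← regDist_succ, lyapunov_sub_eq_regDist] at h3
    change -((2 * K + 1) * regDist L y (X k ω) ^ (p - 1 / 2)) ≤ _ at h3
    have h5 : 0 ≤ h * r ^ 2 * regDist L y (X k ω) ^ (p - 1 / 2) := by
      have := one_le_regDist hL.one_le y (X k ω)
      positivity
    simp only [excitation, if_pos hω]
    linarith
  · exact le_rfl

/-- Fixing the position `z` makes the unit vector orthogonal to `z - y` deterministic, so no
measurable selection is needed; the countably many null sets are united afterwards. Without drift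
the linear term has conditional mean zero, and ellipticity in that direction supplies the gain. -/
theorem condExp_exp_visitStep_le_one_of_eq (hd : 2 ≤ d) (hK : 0 < K) (hh : 0 < h)
    (hL : IsLyapunov d K h r p L ε) (hX : IsGERW μ ℱ K h r drift ℓ A X) (hθ : 0 ≤ θ)
    (hθS : θ * S ^ p ≤ ε) (y z : Fin d → ℤ) (hz : regDist L y z ≤ S) (k : ℕ) :
    ∀ᵐ ω ∂μ, X k ω = z → ¬ IsExcitedAt A X k ω →
      (μ[fun ω => Real.exp (visitStep K h r p L θ S A X y k ω) | ℱ k]) ω ≤ 1 := by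
  have hp := hL.quarter_le
  have hL1 := hL.one_le
  set x := latticePoint z - latticePoint y with hx
  obtain ⟨e, he, hxe⟩ := exists_norm_eq_one_inner_eq_zero hd x
  set s := regDist L y z with hs
  have hs1 : 1 ≤ s := one_le_regDist hL1 y z
  set a := θ * p * s ^ (p - 1) with ha
  have ha0 : 0 ≤ a := by positivity
  set b := Real.exp (θ * (visitGain h r p L * (if z = y then 1 else 0))) with hb
  have hb0 : 0 < b := Real.exp_pos _
  set T := {ω | r < inner ℝ (increment X k ω) e} with hT
  have hTm : MeasurableSet T := ℱ.le (k + 1) _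
    (measurableSet_lt measurable_const (measurable_inner_increment hX.adapted k e))
  set U : Ω → ℝ := fun ω => inner ℝ (increment X k ω) x with hU
  set V : Ω → ℝ := T.indicator fun _ => 1 with hV
  have hUi : Integrable U μ := (integrable_increment hX.adapted hX.bounded k).inner_const x
  have hVi : Integrable V μ := (integrable_const _).indicator hTm
  have hmem : MeasurableSet[ℱ k] ({ω | X k ω ∈ ({z} : Set _)} ∩ {ω | IsExcitedAt A X k ω}ᶜ) :=
    (measurableSet_walk_mem hX.adapted le_rfl {z}).inter
      (measurableSet_isExcitedAt hX.adapted k).compl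
  -- At `z = y` one has `s = L`, and the visit gain is calibrated so that `a * (h * r ^ 2 / 4)`
  -- equals `θ` times it. Elsewhere `b = 1`.
  have hgain : b * (1 - a * (h * r ^ 2 / 4)) ≤ 1 := by
    have hstep : b ≤ Real.exp (a * (h * r ^ 2 / 4)) := by
      rw [hb, Real.exp_le_exp]
      split_ifs with hzy
      · have : s = L := by simp [hs, regDist, hzy]
        rw [ha, this, visitGain]
        apply le_of_eq; ring
      · simp only [mul_zero]
        positivity
    have h1 : 1 - a * (h * r ^ 2 / 4) ≤ Real.exp (-(a * (h * r ^ 2 / 4))) := by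
      linarith [Real.add_one_le_exp (-(a * (h * r ^ 2 / 4)))]
    calc b * (1 - a * (h * r ^ 2 / 4)) ≤ b * Real.exp (-(a * (h * r ^ 2 / 4))) := by gcongr
      _ ≤ Real.exp (a * (h * r ^ 2 / 4)) * Real.exp (-(a * (h * r ^ 2 / 4))) := by gcongr
      _ = 1 := by rw [← Real.exp_add]; simp
  have h1 := condExp_le_condExp_on (μ := μ) (ℱ.le k) hmem
    (f := fun ω => Real.exp (visitStep K h r p L θ S A X y k ω))
    (g := fun ω => b * (1 + a * (3 / 4 * (h * r ^ 2))) + (-2 * a * b) * U ω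
      + (-a * b * r ^ 2) * V ω)
    (integrable_exp_of_le ((measurable_visitStep hX.adapted y k).mono (ℱ.le _) le_rfl) _
      (visitStep_le hK hh hL hX.bounded hθ y k))
    (((integrable_const _).add (hUi.const_mul _)).add (hVi.const_mul _)) (by
      rintro ω ⟨hωz, hωe⟩
      have hωz' : X k ω = z := hωz
      have hωe' : ¬ IsExcitedAt A X k ω := hωe
      have hst := hL.step x (increment X k ω) e he hxe (hX.bounded k ω).le θ hθ
        (le_trans (by
          change θ * s ^ p ≤ θ * S ^ p
          gcongr) hθS)
      have hv : visitStep K h r p L θ S A X y k ω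
          = θ * (visitGain h r p L * (if z = y then 1 else 0))
            + -(θ * (lyapunov p L (x + increment X k ω) - lyapunov p L x)) := by
        rw [visitStep, regDist_succ, hωz', if_pos hz, excitation, if_neg hωe',
          ← lyapunov_sub_eq_regDist]
        ring
      rw [hv, Real.exp_add, ← hb]
      refine (mul_le_mul_of_nonneg_left hst hb0.le).trans (le_of_eq ?_)
      have hVω : (if r < inner ℝ (increment X k ω) e then r ^ 2 else 0) = r ^ 2 * V ω := by
        simp only [hV, hT, Set.indicator_apply, Set.mem_ofPred_eq]
        split_ifs <;> simp
      rw [hVω, real_inner_comm]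
      change b * (1 - a * (2 * U ω + r ^ 2 * V ω - 3 / 4 * (h * r ^ 2))) = _
      ring)
  filter_upwards [h1, condExp_affine (ℱ.le k) hUi hVi (b * (1 + a * (3 / 4 * (h * r ^ 2))))
    (-2 * a * b) (-a * b * r ^ 2), condExp_inner_increment hX.adapted hX.bounded k x,
    hX.drift_eq_zero k, hX.elliptic_of_drift_eq_zero k e he] with ω h1 h2 h3 h4 h5 hωz hωe
  refine (h1 ⟨hωz, hωe⟩).trans ?_
  have h6 := h5 (h4 hωe)
  rw [h2, h3, h4 hωe, inner_zero_left]
  refine le_trans ?_ hgain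
  have h7 : a * b * r ^ 2 * h ≤ a * b * r ^ 2 * (μ[V | ℱ k]) ω := by gcongr
  linarith

theorem condExp_exp_visitStep_le_one (hd : 2 ≤ d) (hK : 0 < K) (hh : 0 < h)
    (hL : IsLyapunov d K h r p L ε) (hX : IsGERW μ ℱ K h r drift ℓ A X) (hθ : 0 ≤ θ)
    (hθS : θ * S ^ p ≤ ε) (y : Fin d → ℤ) (k : ℕ) :
    ∀ᵐ ω ∂μ, (μ[fun ω => Real.exp (visitStep K h r p L θ S A X y k ω) | ℱ k]) ω ≤ 1 := by
  have hi : Integrable (fun ω => Real.exp (visitStep K h r p L θ S A X y k ω)) μ :=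
    integrable_exp_of_le ((measurable_visitStep hX.adapted y k).mono (ℱ.le _) le_rfl) _
      (visitStep_le hK hh hL hX.bounded hθ y k)
  have h1 := condExp_le_one_on (μ := μ) (ℱ.le k) (measurableSet_isExcitedAt (A := A) hX.adapted k)
    hi fun ω hω => Real.exp_le_one_iff.2
      (visitStep_nonpos_of_isExcitedAt hh hL hX.bounded hθ y hω)
  have h2 := condExp_le_one_on (μ := μ) (ℱ.le k)
    (measurableSet_walk_mem hX.adapted (le_refl k) {z | regDist L y z ≤ S}ᶜ) hi fun ω hω => by
      have hω' : ¬ regDist L y (X k ω) ≤ S := hω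
      simp [visitStep, if_neg hω']
  have h3 : ∀ᵐ ω ∂μ, ∀ z, regDist L y z ≤ S → X k ω = z → ¬ IsExcitedAt A X k ω →
      (μ[fun ω => Real.exp (visitStep K h r p L θ S A X y k ω) | ℱ k]) ω ≤ 1 := by
    rw [ae_all_iff]
    intro z
    by_cases hz : regDist L y z ≤ S
    · filter_upwards [condExp_exp_visitStep_le_one_of_eq hd hK hh hL hX hθ hθS y z hz k]
        with ω hω _ using hω
    · exact .of_forall fun ω hz' => absurd hz' hz
  filter_upwards [h1, h2, h3] with ω h1 h2 h3
  by_cases hexc : IsExcitedAt A X k ω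
  · exact h1 hexc
  · by_cases hz : regDist L y (X k ω) ≤ S
    · exact h3 _ hz rfl hexc
    · exact h2 hz

/-- Exponential bound for the number of visits to `y` while the walk stays close to `y`. -/
theorem measureReal_visits_le (hd : 2 ≤ d) (hK : 0 < K) (hh : 0 < h)
    (hL : IsLyapunov d K h r p L ε) (hX : IsGERW μ ℱ K h r drift ℓ A X) (hθ : 0 ≤ θ)
    (hθS : θ * S ^ p ≤ ε) (y : Fin d → ℤ) (n : ℕ) (a : ℝ) :
    μ.real {ω | (∀ k < n, regDist L y (X k ω) ≤ S) ∧
      a ≤ θ * (visitGain h r p L * ((Finset.range n).filter fun k => X k ω = y).card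
        - regDist L y (X n ω) ^ p - (2 * K + 1 + h * r ^ 2) *
          ∑ k ∈ Finset.range n, excitation A X k ω * regDist L y (X k ω) ^ (p - 1 / 2))}
      ≤ Real.exp (-a) := by
  refine le_trans (measureReal_mono ?_) (measureReal_le_exp_neg
    (fun k => measurable_visitStep hX.adapted y k)
    (fun k => ⟨_, visitStep_le hK hh hL hX.bounded hθ y k⟩)
    (condExp_exp_visitStep_le_one hd hK hh hL hX hθ hθS y) n a)
  rintro ω ⟨h1, h2⟩
  refine le_trans h2 ?_
  have h3 : ∑ k ∈ Finset.range n, visitStep K h r p L θ S A X y k ω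
      = θ * (visitGain h r p L * ((Finset.range n).filter fun k => X k ω = y).card
        - (regDist L y (X n ω) ^ p - regDist L y (X 0 ω) ^ p) - (2 * K + 1 + h * r ^ 2) *
          ∑ k ∈ Finset.range n, excitation A X k ω * regDist L y (X k ω) ^ (p - 1 / 2)) := by
    rw [Finset.sum_congr rfl fun k hk => by
      rw [visitStep, if_pos (h1 k (Finset.mem_range.1 hk))],
      ← Finset.mul_sum, Finset.sum_sub_distrib, Finset.sum_sub_distrib, ← Finset.mul_sum,
      ← Finset.mul_sum, Finset.sum_range_sub (fun k => regDist L y (X k ω) ^ p)]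
    simp
  rw [h3]
  gcongr
  have : 0 ≤ regDist L y (X 0 ω) ^ p :=
    Real.rpow_nonneg (by linarith [one_le_regDist hL.one_le y (X 0 ω)]) _
  linarith

end Walk

/-! ### Counting lattice sites and excited times -/

section Counting

variable {d : ℕ}

theorem abs_apply_le_norm (x : EuclideanSpace ℝ (Fin d)) (i : Fin d) : |x i| ≤ ‖x‖ := by
  simpa using PiLp.norm_apply_le x i

theorem norm_le_sum_abs (x : EuclideanSpace ℝ (Fin d)) : ‖x‖ ≤ ∑ i, |x i| := by
  rw [EuclideanSpace.norm_eq]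
  refine Real.sqrt_le_iff.2 ⟨by positivity, ?_⟩
  simp only [Real.norm_eq_abs]
  exact Finset.sum_sq_le_sq_sum_of_nonneg fun i _ => abs_nonneg _

theorem exists_finset_norm_sub_le {ρ : ℝ} (hρ : 0 ≤ ρ) (y : Fin d → ℤ) :
    ∃ B : Finset (Fin d → ℤ), (∀ z, ‖latticePoint z - latticePoint y‖ ≤ ρ → z ∈ B) ∧
      (B.card : ℝ) ≤ (2 * ρ + 1) ^ d := by
  refine ⟨Finset.Icc (y - fun _ => ⌊ρ⌋) (y + fun _ => ⌊ρ⌋), fun z hz => ?_, ?_⟩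
  · have h2 : ∀ i, |z i - y i| ≤ ⌊ρ⌋ := fun i => by
      refine Int.le_floor.2 ?_
      have := (abs_apply_le_norm _ i).trans hz
      simpa [latticePoint] using this
    rw [Finset.mem_Icc, Pi.le_def, Pi.le_def]
    constructor <;> intro i <;> have := abs_le.1 (h2 i) <;> simp <;> linarith
  · have h2 : (Finset.Icc (y - fun _ => ⌊ρ⌋) (y + fun _ => ⌊ρ⌋)).card
        = (2 * ⌊ρ⌋ + 1).toNat ^ d := by
      rw [Pi.card_Icc]
      simp only [Pi.add_apply, Pi.sub_apply, Int.card_Icc]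
      rw [Finset.prod_congr rfl fun i _ => by
        rw [show y i + ⌊ρ⌋ + 1 - (y i - ⌊ρ⌋) = 2 * ⌊ρ⌋ + 1 by ring]]
      simp
    have h3 : (0 : ℤ) ≤ ⌊ρ⌋ := Int.floor_nonneg.2 hρ
    have h4 : (((2 * ⌊ρ⌋ + 1).toNat : ℕ) : ℝ) ≤ 2 * ρ + 1 := by
      have : (((2 * ⌊ρ⌋ + 1).toNat : ℤ) : ℝ) = 2 * (⌊ρ⌋ : ℝ) + 1 := by
        rw [Int.toNat_of_nonneg (by linarith)]; push_cast; ring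
      have h5 := Int.floor_le ρ
      rw [Int.cast_natCast] at this
      linarith
    rw [h2]
    push_cast
    gcongr

theorem card_le_of_norm_sub_le {ρ : ℝ} (hρ : 0 ≤ ρ) (y : Fin d → ℤ) (V : Finset (Fin d → ℤ))
    (hV : ∀ z ∈ V, ‖latticePoint z - latticePoint y‖ ≤ ρ) : (V.card : ℝ) ≤ (2 * ρ + 1) ^ d := by
  obtain ⟨B, hB, hc⟩ := exists_finset_norm_sub_le hρ y
  exact le_trans (by exact_mod_cast Finset.card_le_card fun z hz => hB z (hV z hz)) hc

/-- Each summand is at most one, and the sum is cut at radius `ρ = N ^ (1 / (2d))`. The ball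
contains `O(√N)` sites; each of the at most `N` sites outside contributes at most `ρ ^ (2p - 1)`, a
negative power of `N` because `p < 1/2`. -/
theorem sum_regDist_rpow_le (hd : 2 ≤ d) {p L N : ℝ} (hp0 : 1 / 4 ≤ p) (hp1 : p < 1 / 2)
    (hL : 1 ≤ L) (hN : 1 ≤ N) (y : Fin d → ℤ) (V : Finset (Fin d → ℤ)) (hV : (V.card : ℝ) ≤ N) :
    ∑ z ∈ V, regDist L y z ^ (p - 1 / 2) ≤ (3 ^ d + 1) * N ^ (1 - (1 - 2 * p) / (2 * d)) := by
  have hd' : (2 : ℝ) ≤ d := by exact_mod_cast hd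
  have hN0 : 0 < N := by linarith
  set ρ := N ^ (1 / (2 * d) : ℝ) with hρ
  have hρ1 : 1 ≤ ρ := Real.one_le_rpow hN (by positivity)
  rw [← Finset.sum_filter_add_sum_filter_not V
    (fun z => ‖latticePoint z - latticePoint y‖ ≤ ρ), add_mul, one_mul]
  gcongr
  · have h1 := card_le_of_norm_sub_le (by linarith) y
      (V.filter fun z => ‖latticePoint z - latticePoint y‖ ≤ ρ)
      fun z hz => (Finset.mem_filter.1 hz).2
    calc _ ≤ ∑ z ∈ V.filter fun z => ‖latticePoint z - latticePoint y‖ ≤ ρ, (1 : ℝ) :=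
          Finset.sum_le_sum fun z _ => Real.rpow_le_one_of_one_le_of_nonpos
            (one_le_regDist hL y z) (by linarith)
      _ ≤ (2 * ρ + 1) ^ d := by simpa using h1
      _ ≤ (3 * ρ) ^ d := by gcongr; linarith
      _ = 3 ^ d * N ^ (1 / 2 : ℝ) := by
          rw [mul_pow, hρ, ← Real.rpow_natCast (N ^ _), ← Real.rpow_mul hN0.le]
          congr 2; field_simp
      _ ≤ _ := by
          have : (1 - 2 * p) / (2 * d) ≤ 1 / 2 := by
            rw [div_le_iff₀ (by positivity)]; linarith
          gcongr
          · linarith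
  · calc _ ≤ ∑ z ∈ V.filter fun z => ¬ ‖latticePoint z - latticePoint y‖ ≤ ρ,
          ρ ^ (2 * p - 1) := by
          refine Finset.sum_le_sum fun z hz => ?_
          have hz' := not_le.1 (Finset.mem_filter.1 hz).2
          have h1 : ρ ^ 2 ≤ regDist L y z := by
            unfold regDist; nlinarith
          calc regDist L y z ^ (p - 1 / 2) ≤ (ρ ^ 2) ^ (p - 1 / 2) :=
                Real.rpow_le_rpow_of_nonpos (by positivity) h1 (by linarith)
            _ = ρ ^ (2 * p - 1) := by
                rw [← Real.rpow_natCast ρ 2, ← Real.rpow_mul (by positivity)]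
                congr 1; push_cast; ring
      _ ≤ N * ρ ^ (2 * p - 1) := by
          rw [Finset.sum_const, nsmul_eq_mul]
          gcongr
          refine le_trans ?_ hV
          exact_mod_cast Finset.card_filter_le _ _
      _ = _ := by
          rw [hρ, ← Real.rpow_mul hN0.le]
          nth_rw 1 [← Real.rpow_one N]
          rw [← Real.rpow_add hN0]
          congr 1; field_simp; ring

variable {Ω : Type u} {A : Set (Fin d → ℤ)} {X : ℕ → Ω → (Fin d → ℤ)}

theorem walk_mem_visitedSites (X : ℕ → Ω → (Fin d → ℤ)) {k n : ℕ} (hk : k ≤ n) (ω : Ω) :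
    X k ω ∈ visitedSites X n ω :=
  Finset.mem_image_of_mem _ (Finset.mem_range.2 (by omega))

/-- Excited times are first visits, so the walk is injective on them and every site is charged at
most once. -/
theorem sum_excitation_mul_le (A : Set (Fin d → ℤ)) (X : ℕ → Ω → (Fin d → ℤ)) (n : ℕ) (ω : Ω)
    {f : (Fin d → ℤ) → ℝ} (hf : ∀ z, 0 ≤ f z) :
    ∑ k ∈ Finset.range n, excitation A X k ω * f (X k ω) ≤ ∑ z ∈ visitedSites X n ω, f z := by
  classical
  have h1 : ∑ k ∈ Finset.range n, excitation A X k ω * f (X k ω)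
      = ∑ k ∈ (Finset.range n).filter fun k => IsExcitedAt A X k ω, f (X k ω) := by
    rw [Finset.sum_filter]
    refine Finset.sum_congr rfl fun k _ => ?_
    unfold excitation; split_ifs <;> simp
  have hinj : Set.InjOn (fun k => X k ω)
      ((Finset.range n).filter fun k => IsExcitedAt A X k ω : Finset ℕ) := by
    intro j hj k hk hjk
    have hj := (Finset.mem_filter.1 hj).2.1
    have hk := (Finset.mem_filter.1 hk).2.1
    rcases lt_trichotomy j k with h | h | h
    · exact absurd hjk (hk j h)
    · exact h
    · exact absurd hjk.symm (hj k h)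
  rw [h1, ← Finset.sum_image (g := fun k => X k ω) hinj]
  refine Finset.sum_le_sum_of_subset_of_nonneg (fun z hz => ?_) fun z _ _ => hf z
  obtain ⟨k, hk, rfl⟩ := Finset.mem_image.1 hz
  exact walk_mem_visitedSites X (Finset.mem_range.1 (Finset.mem_filter.1 hk).1).le ω

theorem sum_excitation_le_card (A : Set (Fin d → ℤ)) (X : ℕ → Ω → (Fin d → ℤ)) (n : ℕ) (ω : Ω) :
    ∑ k ∈ Finset.range n, excitation A X k ω ≤ (visitedSites X n ω).card := by
  simpa using sum_excitation_mul_le A X n ω (f := fun _ => 1) fun _ => zero_le_one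

/-- Some site is visited at least as often as the average. -/
theorem exists_div_le_card_visits {N : ℝ} {n : ℕ} {ω : Ω}
    (hN : ((visitedSites X n ω).card : ℝ) < N) : ∃ y ∈ visitedSites X n ω,
      n / N ≤ ((Finset.range n).filter fun k => X k ω = y).card := by
  by_contra! hcon
  have hne : (visitedSites X n ω).Nonempty := ⟨_, walk_mem_visitedSites X le_rfl ω⟩
  have hN0 : 0 < N := lt_of_le_of_lt (Nat.cast_nonneg _) hN
  have h1 := Finset.card_eq_sum_card_fiberwise (s := Finset.range n) (t := visitedSites X n ω)
    (f := fun k => X k ω) fun k hk => walk_mem_visitedSites X (by simpa using (Finset.mem_range.1 hk).le)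
      ω
  have h2 : (n : ℝ) < (visitedSites X n ω).card * (n / N) := by
    calc (n : ℝ) = ∑ y ∈ visitedSites X n ω,
          (((Finset.range n).filter fun k => X k ω = y).card : ℝ) := by
          rw [Finset.card_range] at h1; exact_mod_cast h1
      _ < ∑ y ∈ visitedSites X n ω, n / N := Finset.sum_lt_sum_of_nonempty hne hcon
      _ = _ := by simp
  have h3 : (visitedSites X n ω).card * (n / N) ≤ N * (n / N) := by gcongr
  rw [mul_div_cancel₀ _ hN0.ne'] at h3
  linarith

end Counting

/-! ### Paths that start with pushes -/

section Push

variable {d : ℕ} {Ω : Type u} {r : ℝ} {ℓ : EuclideanSpace ℝ (Fin d)} {X : ℕ → Ω → (Fin d → ℤ)}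

theorem inner_add_le_of_mem_pushEvent {m : ℕ} {ω : Ω} (hω : ω ∈ pushEvent r ℓ X m)
    {j k : ℕ} (hjk : j ≤ k) (hk : k ≤ m) :
    inner ℝ (latticePoint (X j ω)) ℓ + r * ((k : ℝ) - j) ≤ inner ℝ (latticePoint (X k ω)) ℓ := by
  induction k, hjk using Nat.le_induction with
  | base => simp
  | succ k hjk ih =>
    have h1 := ih (by omega)
    have h2 := hω k (by omega)
    rw [increment, inner_sub_left] at h2
    push_cast
    linarith

theorem inner_lt_of_mem_pushEvent (hr : 0 < r) {m : ℕ} {ω : Ω} (hω : ω ∈ pushEvent r ℓ X m)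
    {j k : ℕ} (hjk : j < k) (hk : k ≤ m) :
    inner ℝ (latticePoint (X j ω)) ℓ < inner ℝ (latticePoint (X k ω)) ℓ := by
  have h1 := inner_add_le_of_mem_pushEvent hω hjk.le hk
  have h2 : (j : ℝ) < k := by exact_mod_cast hjk
  nlinarith

theorem walk_ne_of_mem_pushEvent (hr : 0 < r) {m : ℕ} {ω : Ω} (hω : ω ∈ pushEvent r ℓ X m)
    {j k : ℕ} (hjk : j < k) (hk : k ≤ m) : X j ω ≠ X k ω := fun h => by
  have := inner_lt_of_mem_pushEvent hr hω hjk hk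
  rw [h] at this
  exact lt_irrefl _ this

theorem card_visitedSites_of_mem_pushEvent (hr : 0 < r) {m : ℕ} {ω : Ω}
    (hω : ω ∈ pushEvent r ℓ X m) : (visitedSites X m ω).card = m + 1 := by
  rw [visitedSites, Finset.card_image_of_injOn, Finset.card_range]
  intro j hj k hk hjk
  have hj := Finset.mem_range.1 hj
  have hk := Finset.mem_range.1 hk
  rcases lt_trichotomy j k with h | h | h
  · exact absurd hjk (walk_ne_of_mem_pushEvent hr hω h (by omega))
  · exact h
  · exact absurd hjk.symm (walk_ne_of_mem_pushEvent hr hω h (by omega))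

end Push

/-! ### The lower tail of the range -/

open Filter Topology in
theorem tendsto_rpow_mul_exp_neg_mul_rpow {c γ : ℝ} (hc : 0 < c) (hγ : 0 < γ) (b : ℝ) :
    Tendsto (fun n : ℕ => (n : ℝ) ^ b * Real.exp (-c * (n : ℝ) ^ γ)) atTop (𝓝 0) := by
  have h1 := (tendsto_rpow_mul_exp_neg_mul_atTop_nhds_zero (b / γ) c hc).comp
    ((tendsto_rpow_atTop hγ).comp tendsto_natCast_atTop_atTop)
  refine h1.congr fun n => ?_
  simp only [Function.comp_apply]
  rw [← Real.rpow_mul (Nat.cast_nonneg n), mul_div_cancel₀ _ hγ.ne']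

section Range

variable {d : ℕ} {Ω : Type u} {mΩ : MeasurableSpace Ω} {μ : Measure Ω} [IsProbabilityMeasure μ]
  {ℱ : Filtration ℕ mΩ}
  {K h r : ℝ} {drift : ℕ → ℝ} {ℓ : EuclideanSpace ℝ (Fin d)} {A : Set (Fin d → ℤ)}
  {X : ℕ → Ω → (Fin d → ℤ)} {p L ε : ℝ}

theorem norm_walk_le (h0 : ∀ ω, X 0 ω = 0) (hb : ∀ n ω, ‖increment X n ω‖ < K) (n : ℕ) (ω : Ω) :
    ‖latticePoint (X n ω)‖ ≤ K * n := by
  induction n with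
  | zero => simp [h0]
  | succ n ih =>
    have h1 : latticePoint (X (n + 1) ω) = latticePoint (X n ω) + increment X n ω := by
      unfold increment; abel
    have h2 := hb n ω
    rw [h1]
    refine (norm_add_le _ _).trans ?_
    push_cast
    linarith

/-- The range of the walk is at least `N` up to an explicit exponential error. -/
theorem measureReal_card_visitedSites_lt_le (hd : 2 ≤ d) (hK : 0 < K) (hh : 0 < h)
    (hL : IsLyapunov d K h r p L ε) (hX : IsGERW μ ℱ K h r drift ℓ A X) {n : ℕ} (hn : 1 ≤ n)
    {N a θ S R : ℝ} (hN : 1 ≤ N) (hR : √n * (a + K ^ 2 / 2) + K * N ≤ R)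
    (hS : (2 * (d * R)) ^ 2 + L ≤ S) (hθ : 0 ≤ θ) (hθS : θ * S ^ p ≤ ε)
    (ha : a ≤ θ * (visitGain h r p L * (n / N) - S ^ p
      - (2 * K + 1 + h * r ^ 2) * ((3 ^ d + 1) * N ^ (1 - (1 - 2 * p) / (2 * d))))) :
    μ.real {ω | ((visitedSites X n ω).card : ℝ) < N}
      ≤ (2 * d * (n + 1) + (2 * (K * n) + 1) ^ d) * Real.exp (-a) := by
  have hp := hL.quarter_le
  have hL1 := hL.one_le
  have hn0 : (0 : ℝ) < n := by exact_mod_cast hn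
  have hsn : 0 < √(n : ℝ) := Real.sqrt_pos.2 hn0
  -- At this scale the Hoeffding compensator stays below `K ^ 2 / 2` up to time `n`.
  set t := 1 / √(n : ℝ) with ht
  have ht0 : 0 < t := by positivity
  have htn : t ^ 2 * n = 1 := by
    rw [ht, div_pow, Real.sq_sqrt hn0.le]; field_simp
  have hts : √(n : ℝ) * t = 1 := by rw [ht]; field_simp
  obtain ⟨B, hB, hBc⟩ := exists_finset_norm_sub_le (d := d) (by positivity : 0 ≤ K * n) 0
  -- The displacement is controlled for each coordinate, each sign and each time up to `n`.
  set I : Finset ((Fin d × ℤ) × ℕ) :=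
    (Finset.univ ×ˢ {1, -1}) ×ˢ Finset.range (n + 1) with hI
  set E : (Fin d × ℤ) × ℕ → Set Ω := fun i =>
    {ω | a ≤ t * inner ℝ (latticePoint (X i.2 ω)) (EuclideanSpace.single i.1.1 (i.1.2 : ℝ))
      - i.2 * (t ^ 2 * K ^ 2 / 2) - t * K * ∑ k ∈ Finset.range i.2, excitation A X k ω} with hE
  set F : (Fin d → ℤ) → Set Ω := fun y => {ω | (∀ k < n, regDist L y (X k ω) ≤ S) ∧
      a ≤ θ * (visitGain h r p L * ((Finset.range n).filter fun k => X k ω = y).card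
        - regDist L y (X n ω) ^ p - (2 * K + 1 + h * r ^ 2) *
          ∑ k ∈ Finset.range n, excitation A X k ω * regDist L y (X k ω) ^ (p - 1 / 2))} with hF
  have hsub : {ω | ((visitedSites X n ω).card : ℝ) < N} ⊆ (⋃ i ∈ I, E i) ∪ ⋃ y ∈ B, F y := by
    intro ω hω
    have hω : ((visitedSites X n ω).card : ℝ) < N := hω
    by_contra hcon
    simp only [Set.mem_union, Set.mem_iUnion, not_or, not_exists] at hcon
    obtain ⟨hcE, hcF⟩ := hcon
    have hcoord : ∀ k ≤ n, ∀ i : Fin d, ∀ σ : ℤ, σ ∈ ({1, -1} : Finset ℤ) →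
        σ * latticePoint (X k ω) i ≤ R := by
      intro k hk i σ hσ
      have h1 := hcE ((i, σ), k) (by
        simp only [hI, Finset.mem_product, Finset.mem_univ, true_and, Finset.mem_range]
        exact ⟨hσ, by omega⟩)
      simp only [hE, Set.mem_ofPred_eq, not_le, EuclideanSpace.inner_single_right] at h1
      have h2 : ∑ j ∈ Finset.range k, excitation A X j ω ≤ N := by
        refine (Finset.sum_le_sum_of_subset_of_nonneg (Finset.range_mono hk)
          fun j _ _ => excitation_nonneg A X j ω).trans ?_
        exact (sum_excitation_le_card A X n ω).trans hω.le
      have h3 : t * K * ∑ j ∈ Finset.range k, excitation A X j ω ≤ t * K * N := by gcongr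
      have h4 : (k : ℝ) * (t ^ 2 * K ^ 2 / 2) ≤ n * (t ^ 2 * K ^ 2 / 2) := by gcongr
      have h5 : (n : ℝ) * (t ^ 2 * K ^ 2 / 2) = K ^ 2 / 2 := by
        linear_combination K ^ 2 / 2 * htn
      have h6 : t * (σ * latticePoint (X k ω) i) ≤ a + K ^ 2 / 2 + t * K * N := by
        simp at h1
        linarith
      refine le_trans ?_ hR
      calc σ * latticePoint (X k ω) i = √n * (t * (σ * latticePoint (X k ω) i)) := by
            rw [← mul_assoc, hts, one_mul]
        _ ≤ √n * (a + K ^ 2 / 2 + t * K * N) := by gcongr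
        _ = √n * (a + K ^ 2 / 2) + √n * t * (K * N) := by ring
        _ = _ := by rw [hts, one_mul]
    have hnorm : ∀ k ≤ n, ‖latticePoint (X k ω)‖ ≤ d * R := by
      intro k hk
      refine (norm_le_sum_abs _).trans ?_
      calc _ ≤ ∑ i : Fin d, R := Finset.sum_le_sum fun i _ => abs_le.2 ⟨by
              have := hcoord k hk i (-1) (by simp)
              push_cast at this; linarith, by
              have := hcoord k hk i 1 (by simp)
              push_cast at this; linarith⟩
        _ = _ := by simp
    -- The often visited site is random, but it lies in the deterministic set `B`, over which the
    -- union bound runs. Being on the path, it is within `2 * (d * R)` of every position up to time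
    -- `n`.
    obtain ⟨y, hy, hyv⟩ := exists_div_le_card_visits hω
    obtain ⟨j, hj, rfl⟩ := Finset.mem_image.1 hy
    have hj : j ≤ n := Nat.lt_succ_iff.1 (Finset.mem_range.1 hj)
    have hreg : ∀ k ≤ n, regDist L (X j ω) (X k ω) ≤ S := by
      intro k hk
      refine le_trans ?_ hS
      unfold regDist
      gcongr
      refine (norm_sub_le _ _).trans ?_
      linarith [hnorm k hk, hnorm j hj]
    refine hcF (X j ω) (hB _ ?_) ⟨fun k hk => hreg k hk.le, ha.trans ?_⟩
    · rw [latticePoint_zero, sub_zero]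
      refine (norm_walk_le hX.start hX.bounded j ω).trans ?_
      gcongr
    · have hg : 0 ≤ visitGain h r p L := by unfold visitGain; positivity
      have h1 : ∑ k ∈ Finset.range n,
          excitation A X k ω * regDist L (X j ω) (X k ω) ^ (p - 1 / 2)
          ≤ (3 ^ d + 1) * N ^ (1 - (1 - 2 * p) / (2 * d)) :=
        (sum_excitation_mul_le A X n ω fun z => Real.rpow_nonneg
          (by linarith [one_le_regDist hL1 (X j ω) z]) (p - 1 / 2)).trans
          (sum_regDist_rpow_le hd hp hL.lt_half hL1 hN _ _ hω.le)
      have h2 : regDist L (X j ω) (X n ω) ^ p ≤ S ^ p :=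
        Real.rpow_le_rpow (by linarith [one_le_regDist hL1 (X j ω) (X n ω)])
          (hreg n le_rfl) (by linarith)
      gcongr
  have h1 : μ.real (⋃ i ∈ I, E i) ≤ 2 * d * (n + 1) * Real.exp (-a) := by
    refine (measureReal_biUnion_finset_le I E).trans ?_
    calc ∑ i ∈ I, μ.real (E i) ≤ ∑ i ∈ I, Real.exp (-a) := by
          refine Finset.sum_le_sum fun i hi => ?_
          refine measureReal_displacement_le hK hX ?_ ht0.le i.2 a
          simp only [hI, Finset.mem_product, Finset.mem_univ, true_and, Finset.mem_insert,
            Finset.mem_singleton] at hi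
          rcases hi.1 with h | h <;> simp [h]
      _ = _ := by
          rw [Finset.sum_const, nsmul_eq_mul, hI, Finset.card_product, Finset.card_product,
            Finset.card_univ, Fintype.card_fin, Finset.card_range,
            show ({1, -1} : Finset ℤ).card = 2 from rfl]
          push_cast
          ring
  have h2 : μ.real (⋃ y ∈ B, F y) ≤ (2 * (K * n) + 1) ^ d * Real.exp (-a) := by
    refine (measureReal_biUnion_finset_le B F).trans ?_
    calc ∑ y ∈ B, μ.real (F y) ≤ ∑ y ∈ B, Real.exp (-a) := Finset.sum_le_sum fun y _ =>
          measureReal_visits_le hd hK hh hL hX hθ hθS y n a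
      _ = B.card * Real.exp (-a) := by rw [Finset.sum_const, nsmul_eq_mul]
      _ ≤ _ := by gcongr
  calc _ ≤ μ.real ((⋃ i ∈ I, E i) ∪ ⋃ y ∈ B, F y) := measureReal_mono hsub
    _ ≤ _ := measureReal_union_le _ _
    _ ≤ _ := by linarith

-- With `N = n ^ (1/2 + α)`, `a = n ^ α` and `S` of order `N²`, both `S ^ p` and the cost of
-- excitation are `O(N ^ (1 - κ))`. The quotient of `n / N` by `N ^ (1 - κ) * a` is `n ^ (κ/2 - 3α +
-- ακ)`, whose exponent is positive for `α = κ / 8`. The threshold `n₁` does not depend on the walk.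
set_option maxHeartbeats 1000000 in
open Filter Topology in
theorem eventually_measureReal_card_visitedSites_lt (hd : 2 ≤ d) (hK : 0 < K) (hh : 0 < h)
    (hL : IsLyapunov d K h r p L ε) (hr : 0 < r) {α κ : ℝ} (hκ : κ = (1 - 2 * p) / (2 * d))
    (hα : α = κ / 8) : ∃ n₁ : ℕ, 1 ≤ n₁ ∧ ∀ n : ℕ, n₁ ≤ n →
      ∀ (Ω : Type u) (mΩ : MeasurableSpace Ω) (μ : Measure Ω) [IsProbabilityMeasure μ]
        (ℱ : Filtration ℕ mΩ) (drift : ℕ → ℝ) (ℓ : EuclideanSpace ℝ (Fin d))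
        (A : Set (Fin d → ℤ)) (X : ℕ → Ω → (Fin d → ℤ)), IsGERW μ ℱ K h r drift ℓ A X →
        μ.real {ω | ((visitedSites X n ω).card : ℝ) < (n : ℝ) ^ (1 / 2 + α)}
          < Real.exp (-(n : ℝ) ^ (α / 2)) := by
  have hp := hL.quarter_le
  have hp2 := hL.lt_half
  have hL1 := hL.one_le
  have hε := hL.pos
  have hd' : (2 : ℝ) ≤ d := by exact_mod_cast hd
  have hκ0 : 0 < κ := by rw [hκ]; exact div_pos (by linarith) (by linarith)
  have hκp : 2 * p ≤ 1 - κ := by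
    have : κ ≤ 1 - 2 * p := by
      rw [hκ]; exact div_le_self (by linarith) (by linarith)
    linarith
  have hα0 : 0 < α := by rw [hα]; positivity
  set g := visitGain h r p L with hg
  have hg0 : 0 < g := by rw [hg]; unfold visitGain; positivity
  set C₁ := 1 + K ^ 2 / 2 + K with hC₁
  have hC₁0 : 0 < C₁ := by positivity
  set C₂ := (2 * (d * C₁)) ^ 2 + L with hC₂
  have hC₂0 : 0 < C₂ := by positivity
  set D := (2 * K + 1 + h * r ^ 2) * (3 ^ d + 1) with hD
  have hD0 : 0 < D := by positivity
  -- The terms pay for `S ^ p`, for the excited times, and for the target `a`, which costs `a * S ^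
  -- p / ε` when `θ = ε / S ^ p`.
  set C₃ := C₂ ^ p + D + C₂ ^ p / ε with hC₃
  have hC₃0 : 0 < C₃ := by positivity
  have hγ : 0 < κ / 2 - 3 * α + α * κ := by
    have : 0 < α * κ := by positivity
    rw [hα] at this ⊢; linarith
  have hev1 : ∀ᶠ n : ℕ in atTop, C₃ / g ≤ (n : ℝ) ^ (κ / 2 - 3 * α + α * κ) :=
    ((tendsto_rpow_atTop hγ).comp tendsto_natCast_atTop_atTop).eventually_ge_atTop _
  -- This gives `n ^ α ≥ n ^ α / 2 + n ^ (α / 2)`: the first part absorbs the polynomial factor of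
  -- the union bound, the second is the final rate.
  have hev2 : ∀ᶠ n : ℕ in atTop, 2 ≤ (n : ℝ) ^ (α / 2) :=
    ((tendsto_rpow_atTop (half_pos hα0)).comp tendsto_natCast_atTop_atTop).eventually_ge_atTop _
  have hev3 : ∀ᶠ n : ℕ in atTop, (n : ℝ) ^ (d : ℝ) * Real.exp (-(1 / 2) * (n : ℝ) ^ α)
      < 1 / (4 * d + (2 * K + 1) ^ d) :=
    (tendsto_rpow_mul_exp_neg_mul_rpow (by norm_num) hα0 d).eventually_lt_const (by positivity)
  obtain ⟨n₁, hn₁⟩ := eventually_atTop.1 (hev1.and (hev2.and hev3))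
  refine ⟨max n₁ 1, le_max_right _ _, fun n hn Ω mΩ μ _ ℱ drift ℓ A X hX => ?_⟩
  obtain ⟨h1, h2, h3⟩ := hn₁ n ((le_max_left _ _).trans hn)
  have hn1 : 1 ≤ n := (le_max_right _ _).trans hn
  have hn1' : (1 : ℝ) ≤ n := by exact_mod_cast hn1
  have hn0 : (0 : ℝ) < n := by linarith
  set N := (n : ℝ) ^ (1 / 2 + α) with hN
  have hN1 : 1 ≤ N := Real.one_le_rpow hn1' (by linarith)
  have hN0 : 0 < N := by linarith
  set a := (n : ℝ) ^ α with ha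
  have ha1 : 1 ≤ a := Real.one_le_rpow hn1' hα0.le
  have hsqrt : √(n : ℝ) * a = N := by
    rw [Real.sqrt_eq_rpow, ha, ← Real.rpow_add hn0]
  have hsqrt' : √(n : ℝ) ≤ N := by
    rw [← hsqrt]; exact le_mul_of_one_le_right (Real.sqrt_nonneg _) ha1
  set S := C₂ * N ^ 2 with hS
  have hS0 : 0 < S := by positivity
  have hSp : S ^ p = C₂ ^ p * N ^ (2 * p) := by
    rw [hS, Real.mul_rpow hC₂0.le (by positivity), ← Real.rpow_natCast N 2, ← Real.rpow_mul hN0.le]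
    norm_num
  have hNκ : N ^ (2 * p) ≤ N ^ (1 - κ) := Real.rpow_le_rpow_of_exponent_le hN1 hκp
  have hNκ0 : 0 < N ^ (1 - κ) := by positivity
  have hdiv : C₃ * (N ^ (1 - κ) * a) ≤ g * (n / N) := by
    have e1 : (n : ℝ) / N = (n : ℝ) ^ (κ / 2 - 3 * α + α * κ) * (N ^ (1 - κ) * a) := by
      rw [hN, ha, ← Real.rpow_mul hn0.le, ← Real.rpow_add hn0, ← Real.rpow_add hn0]
      nth_rw 1 [← Real.rpow_one (n : ℝ)]
      rw [← Real.rpow_sub hn0]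
      congr 1; ring
    rw [div_le_iff₀ hg0, mul_comm] at h1
    rw [e1, ← mul_assoc g]
    exact mul_le_mul_of_nonneg_right h1 (by positivity)
  have hbound := measureReal_card_visitedSites_lt_le (N := N) (a := a) (θ := ε / S ^ p) (S := S)
    (R := C₁ * N) hd hK hh hL hX hn1 hN1
    (by
      have e1 : √(n : ℝ) * (K ^ 2 / 2) ≤ N * (K ^ 2 / 2) := by gcongr
      rw [mul_add, hsqrt, hC₁]
      linarith)
    (by
      have e1 : L ≤ L * N ^ 2 := le_mul_of_one_le_right (by linarith) (one_le_pow₀ hN1)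
      have e2 : (2 * (d * (C₁ * N))) ^ 2 = (2 * (d * C₁)) ^ 2 * N ^ 2 := by ring
      rw [hS, hC₂, e2, add_mul]
      linarith)
    (by positivity) (by
      rw [div_mul_cancel₀ _ (by positivity)])
    (by
      rw [← hκ, ← hg, ← mul_assoc, ← hD]
      have e1 : S ^ p ≤ C₂ ^ p * (N ^ (1 - κ) * a) := by
        rw [hSp]
        gcongr
        exact hNκ.trans (le_mul_of_one_le_right hNκ0.le ha1)
      have e2 : D * N ^ (1 - κ) ≤ D * (N ^ (1 - κ) * a) := by
        gcongr
        exact le_mul_of_one_le_right hNκ0.le ha1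
      have e3 : C₂ ^ p / ε * (N ^ (1 - κ) * a)
          ≤ g * (n / N) - S ^ p - D * N ^ (1 - κ) := by
        have e4 : C₃ * (N ^ (1 - κ) * a) = C₂ ^ p * (N ^ (1 - κ) * a) + D * (N ^ (1 - κ) * a)
          + C₂ ^ p / ε * (N ^ (1 - κ) * a) := by rw [hC₃]; ring
        linarith
      calc a = ε / S ^ p * (C₂ ^ p / ε * (N ^ (2 * p) * a)) := by
            rw [hSp]; field_simp
        _ ≤ ε / S ^ p * (C₂ ^ p / ε * (N ^ (1 - κ) * a)) := by gcongr
        _ ≤ _ := by gcongr)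
  refine hbound.trans_lt ?_
  have f1 : 2 * d * ((n : ℝ) + 1) + (2 * (K * n) + 1) ^ d
      ≤ (4 * d + (2 * K + 1) ^ d) * (n : ℝ) ^ (d : ℝ) := by
    rw [Real.rpow_natCast, add_mul, ← mul_pow]
    have g1 : (n : ℝ) ≤ (n : ℝ) ^ d := le_self_pow₀ hn1' (by omega)
    have g2 : 2 * d * ((n : ℝ) + 1) ≤ 4 * d * (n : ℝ) ^ d := by
      calc 2 * d * ((n : ℝ) + 1) ≤ 2 * d * (2 * (n : ℝ) ^ d) := by gcongr; linarith
        _ = _ := by ring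
    have g3 : 2 * (K * n) + 1 ≤ (2 * K + 1) * n := by linarith
    gcongr
  have hsq : (n : ℝ) ^ (α / 2) * (n : ℝ) ^ (α / 2) = a := by
    rw [← Real.rpow_add hn0, add_halves]
  have f2 : -a ≤ -(1 / 2) * a + -(n : ℝ) ^ (α / 2) := by
    have := mul_le_mul_of_nonneg_right h2 (by positivity : 0 ≤ (n : ℝ) ^ (α / 2))
    linarith
  rw [lt_div_iff₀ (by positivity)] at h3
  calc _ ≤ (4 * d + (2 * K + 1) ^ d) * (n : ℝ) ^ (d : ℝ)
        * (Real.exp (-(1 / 2) * a) * Real.exp (-(n : ℝ) ^ (α / 2))) := by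
        rw [← Real.exp_add]
        gcongr
    _ = ((n : ℝ) ^ (d : ℝ) * Real.exp (-(1 / 2) * a) * (4 * d + (2 * K + 1) ^ d))
        * Real.exp (-(n : ℝ) ^ (α / 2)) := by ring
    _ < 1 * Real.exp (-(n : ℝ) ^ (α / 2)) := by gcongr
    _ = _ := one_mul _

/-- Only `n < n₁` is left to treat. If the first `n` steps are pushes, all `n + 1` sites are
distinct, so failure has probability at most `1 - h ^ n₁`. The second entry of the minimum defining
`γ₁` keeps the exponential at least `1 - h ^ n₁ / 2` for these `n`. -/
theorem exists_isRangeExponent (hd : 2 ≤ d) (hK : 0 < K) (hh : 0 < h) (hr : 0 < r) :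
    ∃ α γ₁ γ₂ : ℝ, IsRangeExponent.{u} d K h r α γ₁ γ₂ := by
  obtain ⟨p, L, ε, hL⟩ := exists_isLyapunov d hK hh hr
  have hp := hL.quarter_le
  have hp2 := hL.lt_half
  have hd' : (2 : ℝ) ≤ d := by exact_mod_cast hd
  set κ := (1 - 2 * p) / (2 * d) with hκ
  have hκ0 : 0 < κ := div_pos (by linarith) (by linarith)
  have hκ1 : κ ≤ 1 := by
    rw [hκ]; exact (div_le_one (by linarith)).2 (by linarith)
  set α := κ / 8 with hα
  have hα0 : 0 < α := by positivity
  obtain ⟨n₁, hn₁, hrange⟩ := eventually_measureReal_card_visitedSites_lt.{u} hd hK hh hL hr hκ hα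
  have hn₁' : (1 : ℝ) ≤ n₁ := by exact_mod_cast hn₁
  have hγ : 0 < min 1 (h ^ n₁ / (2 * n₁)) := by positivity
  refine ⟨α, min 1 (h ^ n₁ / (2 * n₁)), α / 2, hα0, by linarith, hγ, by positivity,
    fun Ω mΩ μ _ ℱ drift ℓ A X hX n hn => ?_⟩
  have hn' : (1 : ℝ) ≤ n := by exact_mod_cast hn
  rcases le_or_gt n₁ n with hle | hlt
  · refine (hrange n hle Ω mΩ μ ℱ drift ℓ A X hX).trans_le ?_
    have h1 : min 1 (h ^ n₁ / (2 * n₁)) * (n : ℝ) ^ (α / 2) ≤ 1 * (n : ℝ) ^ (α / 2) := by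
      gcongr; exact min_le_left _ _
    rw [Real.exp_le_exp]
    linarith
  · have hh1 := ellipticity_le_one hh hX
    have hsub : {ω | ((visitedSites X n ω).card : ℝ) < (n : ℝ) ^ (1 / 2 + α)}
        ⊆ (pushEvent r ℓ X n)ᶜ := by
      intro ω hω hpush
      have hω : ((visitedSites X n ω).card : ℝ) < (n : ℝ) ^ (1 / 2 + α) := hω
      rw [card_visitedSites_of_mem_pushEvent hr hpush] at hω
      have : (n : ℝ) ^ (1 / 2 + α) ≤ (n : ℝ) ^ (1 : ℝ) :=
        Real.rpow_le_rpow_of_exponent_le hn' (by linarith)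
      rw [Real.rpow_one] at this
      push_cast at hω
      linarith
    have hm : MeasurableSet (pushEvent r ℓ X n) :=
      ℱ.le n _ (measurableSet_pushEvent hX.adapted n)
    have h1 : μ.real (pushEvent r ℓ X n)ᶜ ≤ 1 - h ^ n₁ := by
      rw [probReal_compl_eq_one_sub hm]
      have h2 := pow_le_measureReal_pushEvent hh hX n
      have h3 : h ^ n₁ ≤ h ^ n := pow_le_pow_of_le_one hh.le hh1 hlt.le
      linarith
    refine (measureReal_mono hsub).trans_lt (h1.trans_lt ?_)
    have h2 : (n : ℝ) ^ (α / 2) ≤ n₁ := by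
      calc (n : ℝ) ^ (α / 2) ≤ (n : ℝ) ^ (1 : ℝ) :=
            Real.rpow_le_rpow_of_exponent_le hn' (by linarith)
        _ ≤ n₁ := by rw [Real.rpow_one]; exact_mod_cast hlt.le
    have h3 : min 1 (h ^ n₁ / (2 * n₁)) * (n : ℝ) ^ (α / 2) ≤ h ^ n₁ / 2 := by
      calc _ ≤ h ^ n₁ / (2 * n₁) * n₁ := by gcongr; exact min_le_right _ _
        _ = _ := by field_simp
    have h4 := Real.add_one_le_exp (-min 1 (h ^ n₁ / (2 * n₁)) * (n : ℝ) ^ (α / 2))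
    have h5 : 0 < h ^ n₁ := by positivity
    linarith

end Range

/-! ### Restarting the walk, and concentration with drift -/

theorem condExp_cond {Ω F : Type*} {m m0 : MeasurableSpace Ω} [NormedAddCommGroup F]
    [NormedSpace ℝ F] [CompleteSpace F] {μ : Measure Ω} [IsProbabilityMeasure μ]
    (hm : m ≤ m0) {E : Set Ω} (hE : MeasurableSet[m] E) (hE0 : μ E ≠ 0) {f : Ω → F}
    (hf : Integrable f μ) : (cond μ E)[f | m] =ᵐ[cond μ E] μ[f | m] := by
  have := cond_isProbabilityMeasure hE0
  have hint : ∀ {g : Ω → F}, Integrable g μ → Integrable g (cond μ E) := fun hg =>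
    hg.restrict.smul_measure (ENNReal.inv_ne_top.2 hE0)
  refine (ae_eq_condExp_of_forall_setIntegral_eq hm (hint hf)
    (fun s _ _ => (hint integrable_condExp).integrableOn) (fun s hs _ => ?_)
    stronglyMeasurable_condExp.aestronglyMeasurable).symm
  simp only [ProbabilityTheory.cond, Measure.restrict_smul, integral_smul_measure,
    Measure.restrict_restrict (hm s hs)]
  -- Since `E` belongs to `m`, so does `s ∩ E`; the normalization is the same on both sides.
  rw [setIntegral_condExp hm hf (hs.inter hE)]

/-- The filtration `ℱ`, started at time `m`. -/
def shiftFiltration {Ω : Type*} {mΩ : MeasurableSpace Ω} (ℱ : Filtration ℕ mΩ) (m : ℕ) :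
    Filtration ℕ mΩ where
  seq n := ℱ (m + n)
  mono' _ _ h := ℱ.mono (Nat.add_le_add_left h m)
  le' n := ℱ.le (m + n)

section Restart

variable {d : ℕ} {Ω : Type u} {mΩ : MeasurableSpace Ω} {μ : Measure Ω} [IsProbabilityMeasure μ]
  {ℱ : Filtration ℕ mΩ}
  {K h r : ℝ} {drift : ℕ → ℝ} {ℓ : EuclideanSpace ℝ (Fin d)} {A : Set (Fin d → ℤ)}
  {X : ℕ → Ω → (Fin d → ℤ)}

/-- Conditioned on its path up to time `m`, the walk started afresh at time `m` is again a
generalized excited random walk. -/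
theorem isGERW_restart (hX : IsGERW μ ℱ K h r drift ℓ A X) {m : ℕ} {w : ℕ → (Fin d → ℤ)}
    {E : Set Ω} (hE : MeasurableSet[ℱ m] E) (hE0 : μ E ≠ 0)
    (hw : ∀ ω ∈ E, ∀ k ≤ m, X k ω = w k) (hwA : w m ∈ A) (hwne : ∀ k < m, w m ≠ w k) :
    IsGERW (cond μ E) (shiftFiltration ℱ m) K h r (fun n => drift (m + n)) ℓ
      {z | z + w m ∈ A ∧ ∀ k < m, z + w m ≠ w k} (fun n ω => X (m + n) ω - X m ω) := by
  set Y : ℕ → Ω → (Fin d → ℤ) := fun n ω => X (m + n) ω - X m ω with hY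
  set A' : Set (Fin d → ℤ) := {z | z + w m ∈ A ∧ ∀ k < m, z + w m ≠ w k} with hA'
  have hEm : MeasurableSet E := ℱ.le m E hE
  have hEn : ∀ n, MeasurableSet[ℱ (m + n)] E := fun n => ℱ.mono (Nat.le_add_right m n) E hE
  have hinc : ∀ n ω, increment Y n ω = increment X (m + n) ω := fun n ω => by
    simp only [increment, hY, latticePoint_sub, ← add_assoc]
    abel
  have hinc' : ∀ n, increment Y n = increment X (m + n) := fun n => funext (hinc n)
  have hcond : ∀ n, ∀ᵐ ω ∂(cond μ E), ((cond μ E)[increment Y n | shiftFiltration ℱ m n]) ω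
      = (μ[increment X (m + n) | ℱ (m + n)]) ω := fun n => by
    rw [hinc']
    exact condExp_cond (ℱ.le (m + n)) (hEn n) hE0 (integrable_increment hX.adapted hX.bounded _)
  have hcondP : ∀ n e, ∀ᵐ ω ∂(cond μ E),
      ((cond μ E)⟦{ω' | r < inner ℝ (increment Y n ω') e} | shiftFiltration ℱ m n⟧) ω
      = (μ⟦{ω' | r < inner ℝ (increment X (m + n) ω') e} | ℱ (m + n)⟧) ω := fun n e => by
    simp_rw [hinc]
    refine condExp_cond (ℱ.le (m + n)) (hEn n) hE0 ((integrable_const _).indicator ?_)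
    exact ℱ.le (m + n + 1) _
      (measurableSet_lt measurable_const (measurable_inner_increment hX.adapted (m + n) e))
  -- A site is new for the whole walk exactly when it is new since time `m` and off the old path.
  -- Removing the old path from `A'` encodes the second condition.
  have hexc : ∀ n, ∀ ω ∈ E, (IsExcitedAt A' Y n ω ↔ IsExcitedAt A X (m + n) ω) := by
    intro n ω hω
    have hXm := hw ω hω m le_rfl
    have e1 : Y n ω + w m = X (m + n) ω := by simp [hY, hXm]
    simp only [IsExcitedAt, hA', Set.mem_ofPred_eq, e1]
    constructor
    · rintro ⟨h1, h2, h3⟩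
      refine ⟨fun k hk hkn => ?_, h2⟩
      rcases lt_or_ge k m with hkm | hkm
      · exact h3 k hkm (hkn ▸ hw ω hω k hkm.le)
      · obtain ⟨j, rfl⟩ := Nat.exists_eq_add_of_le hkm
        exact h1 j (by omega) (by simp only [hY, hkn])
    · rintro ⟨h1, h2⟩
      refine ⟨fun k hk hkn => ?_, h2, fun k hk hkn => ?_⟩
      · exact h1 (m + k) (by omega) (sub_left_injective hkn)
      · exact h1 k (by omega) ((hw ω hω k hk.le).trans hkn.symm)
  refine ⟨hX.norm_direction, fun n => hX.drift_pos _, ⟨0, ?_⟩, fun n => ?_, fun ω => ?_,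
    fun n ω => ?_, fun n => ?_, fun n => ?_, fun n => ?_, fun n e he => ?_⟩
  · simpa [hA'] using ⟨hwA, hwne⟩
  · exact (hX.adapted (m + n)).sub ((hX.adapted m).mono (ℱ.mono (Nat.le_add_right m n)) le_rfl)
  · simp [hY]
  · rw [hinc]; exact hX.bounded _ _
  · filter_upwards [hcond n, ae_cond_mem hEm, cond_absolutelyContinuous.ae_le
      (hX.drift_le (m + n))] with ω h1 h2 h3 h4
    rw [h1]
    exact h3 ((hexc n ω h2).1 h4)
  · filter_upwards [hcond n, ae_cond_mem hEm, cond_absolutelyContinuous.ae_le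
      (hX.drift_eq_zero (m + n))] with ω h1 h2 h3 h4
    rw [h1]
    exact h3 fun h5 => h4 ((hexc n ω h2).2 h5)
  · filter_upwards [hcondP n ℓ, cond_absolutelyContinuous.ae_le
      (hX.elliptic_direction (m + n))] with ω h1 h2
    rwa [h1]
  · filter_upwards [hcondP n e, hcond n, cond_absolutelyContinuous.ae_le
      (hX.elliptic_of_drift_eq_zero (m + n) e he)] with ω h1 h2 h3 h4
    rw [h1]
    rw [h2] at h4
    exact h3 h4

/-- Azuma's inequality for the walk in direction `ℓ`, with part of the drift subtracted. -/
theorem measureReal_inner_walk_sub_le (hK : 0 < K) (hX : IsGERW μ ℱ K h r drift ℓ A X)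
    {w : ℕ → ℝ} {W : ℝ} (hw0 : ∀ k, 0 ≤ w k) (hwd : ∀ k, w k ≤ drift k) (hwW : ∀ k, w k ≤ W)
    {n : ℕ} (hn : 1 ≤ n) {a : ℝ} (ha : 0 ≤ a) :
    μ.real {ω | inner ℝ (latticePoint (X n ω)) ℓ
      - ∑ k ∈ Finset.range n, w k * excitation A X k ω ≤ -a}
      ≤ Real.exp (-(a ^ 2 / (2 * n * (K + W) ^ 2))) := by
  have hn0 : (0 : ℝ) < n := by exact_mod_cast hn
  have hW : 0 ≤ W := (hw0 0).trans (hwW 0)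
  set B := K + W with hB
  have hB0 : 0 < B := by positivity
  set U : ℕ → Ω → ℝ := fun k ω => inner ℝ (increment X k ω) ℓ - w k * excitation A X k ω with hU
  have hUm : ∀ k, Measurable[ℱ (k + 1)] (U k) := fun k =>
    (measurable_inner_increment hX.adapted k ℓ).sub
      (((measurable_excitation hX.adapted k).mono (ℱ.mono k.le_succ) le_rfl).const_mul _)
  have hUb : ∀ k ω, |U k ω| ≤ B := fun k ω => by
    have h1 := abs_inner_increment_le hX.bounded k ω hX.norm_direction
    have h2 := excitation_nonneg A X k ω
    have h3 : w k * excitation A X k ω ≤ W := by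
      calc w k * excitation A X k ω ≤ w k * 1 :=
            mul_le_mul_of_nonneg_left (excitation_le_one A X k ω) (hw0 k)
        _ ≤ W := by rw [mul_one]; exact hwW k
    have h4 : 0 ≤ w k * excitation A X k ω := mul_nonneg (hw0 k) h2
    have h5 := abs_le.1 h1
    rw [abs_le]
    constructor <;> simp only [hU] <;> linarith
  have hU0 : ∀ k, ∀ᵐ ω ∂μ, ω ∈ Set.univ → 0 ≤ (μ[U k | ℱ k]) ω := fun k => by
    have hi : Integrable (fun ω => inner ℝ (increment X k ω) ℓ) μ :=
      (integrable_increment hX.adapted hX.bounded k).inner_const ℓ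
    have hem := measurable_excitation (A := A) hX.adapted k
    have hei : Integrable (excitation A X k) μ :=
      integrable_of_abs_le (hem.mono (ℱ.le k) le_rfl) 1 fun ω => by
        rw [abs_of_nonneg (excitation_nonneg A X k ω)]; exact excitation_le_one A X k ω
    have h1 := condExp_affine (μ := μ) (ℱ.le k) hi hei 0 1 (-w k)
    have h2 : U k = fun ω => 0 + 1 * inner ℝ (increment X k ω) ℓ + -w k * excitation A X k ω := by
      ext ω; simp only [hU]; ring
    rw [h2]
    filter_upwards [h1, condExp_inner_increment hX.adapted hX.bounded k ℓ, hX.drift_le k,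
      hX.drift_eq_zero k] with ω h1 h2 h3 h4 _
    rw [h1, h2, condExp_of_stronglyMeasurable (ℱ.le k) hem.stronglyMeasurable hei]
    by_cases hω : IsExcitedAt A X k ω
    · rw [excitation, if_pos hω]
      linarith [h3 hω, hwd k]
    · rw [excitation, if_neg hω, h4 hω, inner_zero_left]
      simp
  -- The minimizer of the Chernoff exponent `-t a + n t² B² / 2`.
  set t := a / (n * B ^ 2) with ht
  have ht0 : 0 ≤ t := by positivity
  have hmain := measureReal_le_exp_neg (μ := μ) (ℱ := ℱ)
    (ξ := fun k ω => -t * U k ω - t ^ 2 * B ^ 2 / 2)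
    (fun k => ((hUm k).const_mul _).sub_const _)
    (fun k => ⟨t * B, fun ω => by
      have := (abs_le.1 (hUb k ω)).1
      have : t * (-U k ω) ≤ t * B := mul_le_mul_of_nonneg_left (by linarith) ht0
      linarith [mul_nonneg (sq_nonneg t) (sq_nonneg B)]⟩)
    (fun k => by
      filter_upwards [condExp_exp_le_one (μ := μ) (ℱ.le k) ((hUm k).mono (ℱ.le _) le_rfl) hB0 ht0
        (hUb k) (hU0 k)] with ω hω using hω (Set.mem_univ ω))
    n (a ^ 2 / (2 * n * B ^ 2))
  refine le_trans (measureReal_mono fun ω hω => ?_) hmain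
  have hω : inner ℝ (latticePoint (X n ω)) ℓ
      - ∑ k ∈ Finset.range n, w k * excitation A X k ω ≤ -a := hω
  rw [inner_walk_eq_sum hX.start, ← Finset.sum_sub_distrib] at hω
  change _ ≤ ∑ k ∈ Finset.range n, (-t * U k ω - t ^ 2 * B ^ 2 / 2)
  rw [Finset.sum_sub_distrib, ← Finset.mul_sum, Finset.sum_const, Finset.card_range, nsmul_eq_mul]
  have h1 : t * a ≤ -t * ∑ k ∈ Finset.range n, U k ω := by
    have := mul_le_mul_of_nonneg_left hω ht0
    linarith
  have h2 : a ^ 2 / (2 * n * B ^ 2) = t * a - n * (t ^ 2 * B ^ 2 / 2) := by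
    rw [ht]; field_simp; ring
  linarith

/-- All visited sites are excited, except for the last one and those of `P`. -/
theorem card_visitedSites_le_sum_excitation {P : Finset (Fin d → ℤ)} {n : ℕ} {ω : Ω}
    (hA : ∀ k < n, X k ω ∈ A ∨ X k ω ∈ P) :
    ((visitedSites X n ω).card : ℝ) ≤ 1 + P.card + ∑ k ∈ Finset.range n, excitation A X k ω := by
  classical
  set T := (Finset.range n).filter fun k => IsExcitedAt A X k ω with hT
  -- Each site is traced to its first visit, which is excited unless it happens at time `n` or the
  -- site is in `P`.
  have h1 : visitedSites X n ω ⊆ ({X n ω} ∪ P) ∪ T.image fun k => X k ω := by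
    intro z hz
    obtain ⟨j, hj, hjz⟩ := Finset.mem_image.1 hz
    have hex : ∃ k, X k ω = z := ⟨j, hjz⟩
    have hk := Nat.find_spec hex
    have hkj : Nat.find hex ≤ j := Nat.find_min' hex hjz
    have hjn := Finset.mem_range.1 hj
    set k := Nat.find hex with hkdef
    simp only [Finset.mem_union, Finset.mem_singleton, Finset.mem_image]
    rcases (show k < n ∨ k = n by omega) with hkn | hkn
    · by_cases hzP : z ∈ P
      · exact Or.inl (Or.inr hzP)
      · refine Or.inr ⟨k, Finset.mem_filter.2 ⟨Finset.mem_range.2 hkn, fun i hi hik => ?_, ?_⟩, hk⟩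
        · exact Nat.find_min hex hi (hik.trans hk)
        · rcases hA k hkn with h | h
          · exact h
          · exact absurd (hk ▸ h) hzP
    · exact Or.inl (Or.inl (by rw [← hk, hkn]))
  have h2 : (visitedSites X n ω).card ≤ 1 + P.card + T.card := by
    refine (Finset.card_le_card h1).trans ((Finset.card_union_le _ _).trans ?_)
    refine add_le_add ((Finset.card_union_le _ _).trans ?_) Finset.card_image_le
    simp
  have h3 : ∑ k ∈ Finset.range n, excitation A X k ω = T.card := by
    simp [excitation, hT]
  rw [h3]
  exact_mod_cast h2

end Restart

/-! ### Staying in the half-space -/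

theorem summable_exp_neg_mul_rpow {c γ : ℝ} (hc : 0 < c) (hγ : 0 < γ) :
    Summable fun n : ℕ => Real.exp (-c * (n : ℝ) ^ γ) := by
  have h1 := (tendsto_rpow_mul_exp_neg_mul_rpow hc hγ 2).eventually_le_const zero_lt_one
  refine summable_of_isBigO_nat (Real.summable_nat_rpow.2 (by norm_num : (-2 : ℝ) < -1)) ?_
  refine Asymptotics.IsBigO.of_bound 1 ?_
  filter_upwards [h1, Filter.eventually_gt_atTop 0] with n hn hn0
  have hn0' : (0 : ℝ) < n := by exact_mod_cast hn0
  rw [Real.norm_of_nonneg (Real.exp_pos _).le, Real.norm_of_nonneg (by positivity), one_mul,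
    Real.rpow_neg hn0'.le, ← one_div, le_div_iff₀ (by positivity), mul_comm]
  exact hn

theorem measureReal_iUnion_le_half {Ω : Type*} {mΩ : MeasurableSpace Ω} {μ : Measure Ω}
    [IsFiniteMeasure μ] {F : ℕ → Set Ω} {q : ℕ → ℝ} (hq : Summable q) (hq0 : ∀ n, 0 ≤ q n) {M : ℕ}
    (hM : ∑' n, q (n + M) ≤ 1 / 2) (hF : ∀ n < M, F n = ∅) (hFq : ∀ n, M ≤ n → μ.real (F n) ≤ q n) :
    μ.real (⋃ n, F n) ≤ 1 / 2 := by
  have h1 : ⋃ n, F n ⊆ ⋃ n, F (n + M) := by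
    intro ω hω
    obtain ⟨n, hn⟩ := Set.mem_iUnion.1 hω
    rcases lt_or_ge n M with h | h
    · rw [hF n h] at hn; exact hn.elim
    · exact Set.mem_iUnion.2 ⟨n - M, by rwa [Nat.sub_add_cancel h]⟩
  have h2 : μ (⋃ n, F n) ≤ ENNReal.ofReal (1 / 2) := by
    calc μ (⋃ n, F n) ≤ μ (⋃ n, F (n + M)) := measure_mono h1
      _ ≤ ∑' n, μ (F (n + M)) := measure_iUnion_le _
      _ ≤ ∑' n, ENNReal.ofReal (q (n + M)) := by
          refine ENNReal.tsum_le_tsum fun n => ?_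
          rw [← ofReal_measureReal]
          exact ENNReal.ofReal_le_ofReal (hFq _ (Nat.le_add_left _ _))
      _ = ENNReal.ofReal (∑' n, q (n + M)) :=
          (ENNReal.ofReal_tsum_of_nonneg (fun n => hq0 _) ((summable_nat_add_iff M).2 hq)).symm
      _ ≤ _ := ENNReal.ofReal_le_ofReal hM
  exact ENNReal.toReal_le_of_le_ofReal (by norm_num) h2

open Filter Topology in
/-- Started far enough inside the half-space, where all sites outside of a small finite set are
excited, the walk stays in the half-space with probability at least one half. -/
theorem exists_half_le_measureReal_stay {d : ℕ} {K h r α γ₁ γ₂ β lam B : ℝ} (hK : 0 < K)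
    (hr : 0 < r) (hR : IsRangeExponent.{u} d K h r α γ₁ γ₂) (hβ0 : 0 ≤ β) (hβ : β < α)
    (hlam : 0 < lam) (hB : 0 < B) :
    ∃ m₀ : ℕ, 1 ≤ m₀ ∧ ∀ (m : ℕ), m₀ ≤ m → ∀ n₀ : ℕ, (n₀ : ℝ) ≤ B * m →
      ∀ (Ω : Type u) (mΩ : MeasurableSpace Ω) (μ : Measure Ω) [IsProbabilityMeasure μ]
        (ℱ : Filtration ℕ mΩ) (drift : ℕ → ℝ) (ℓ : EuclideanSpace ℝ (Fin d))
        (A : Set (Fin d → ℤ)) (X : ℕ → Ω → (Fin d → ℤ)), IsGERW μ ℱ K h r drift ℓ A X →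
        (∀ n : ℕ, lam * ((n₀ : ℝ) + m + n) ^ (-β) ≤ drift n) →
        ∀ (x : ℝ) (P : Finset (Fin d → ℤ)), r * m ≤ x → P.card ≤ m →
          (∀ z, -x < inner ℝ (latticePoint z) ℓ → z ∈ A ∨ z ∈ P) →
          1 / 2 ≤ μ.real {ω | ∀ n, -x < inner ℝ (latticePoint (X n ω)) ℓ} := by
  have hα0 := hR.pos
  have hα6 := hR.lt_sixth
  -- `c₁` and `c₂` are the Azuma rates for a deviation `r n ^ (1/2 + α) / 4` without drift, and for
  -- a deviation `v n ^ (1/2 + α) / 4` with `v` a lower bound for the drift up to time `n`.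
  set c₁ := r ^ 2 / (32 * K ^ 2) with hc₁
  have hc₁0 : 0 < c₁ := by positivity
  set c₂ := (lam * (B + 2) ^ (-β) / 4) ^ 2 / (2 * (K + lam) ^ 2) with hc₂
  have hc₂0 : 0 < c₂ := by positivity
  set q : ℕ → ℝ := fun n => Real.exp (-c₁ * (n : ℝ) ^ (2 * α)) + Real.exp (-γ₁ * (n : ℝ) ^ γ₂)
    + Real.exp (-c₂ * (n : ℝ) ^ (2 * (α - β))) with hq
  have hqs : Summable q := ((summable_exp_neg_mul_rpow hc₁0 (by linarith)).add
    (summable_exp_neg_mul_rpow hR.pos₁ hR.pos₂)).add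
    (summable_exp_neg_mul_rpow hc₂0 (by linarith))
  have hq0 : ∀ n, 0 ≤ q n := fun n => by positivity
  obtain ⟨M, hM⟩ := eventually_atTop.1 (((tendsto_sum_nat_add q).eventually_le_const
    (by norm_num : (0 : ℝ) < 1 / 2)).and (eventually_ge_atTop 4))
  obtain ⟨hM1, hM4⟩ := hM M le_rfl
  -- A height `r m ≥ K M` cannot be lost in fewer than `M` steps, so only the tail of the summable
  -- bound from `M` on matters.
  refine ⟨⌈K * M / r⌉₊ + 1, by omega, fun m hm n₀ hn₀ Ω mΩ μ _ ℱ drift ℓ A X hX hdrift x P hx hP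
    hAP => ?_⟩
  have hmr : K * M ≤ r * m := by
    have h1 : K * M / r ≤ m := (Nat.le_ceil _).trans (by exact_mod_cast (by omega))
    rw [div_le_iff₀ hr] at h1
    linarith
  have hm1 : (1 : ℝ) ≤ m := by exact_mod_cast (show 1 ≤ m by omega)
  -- Decomposition by the first exit time: all earlier positions are in the half-space, hence in `A
  -- ∪ P`.
  set F : ℕ → Set Ω := fun n => {ω | (∀ k < n, -x < inner ℝ (latticePoint (X k ω)) ℓ) ∧
    inner ℝ (latticePoint (X n ω)) ℓ ≤ -x} with hF
  have hcompl : {ω | ∀ n, -x < inner ℝ (latticePoint (X n ω)) ℓ}ᶜ ⊆ ⋃ n, F n := by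
    intro ω hω
    have hω : ¬ ∀ n, -x < inner ℝ (latticePoint (X n ω)) ℓ := hω
    push Not at hω
    refine Set.mem_iUnion.2 ⟨Nat.find hω, fun k hk => ?_, Nat.find_spec hω⟩
    exact not_le.1 (Nat.find_min hω hk)
  have hempty : ∀ n < M, F n = ∅ := by
    intro n hn
    refine Set.eq_empty_of_forall_notMem fun ω hω => ?_
    have h1 : inner ℝ (latticePoint (X n ω)) ℓ ≤ -x := hω.2
    have h2 : |inner ℝ (latticePoint (X n ω)) ℓ| ≤ K * n :=
      (abs_real_inner_le_norm (latticePoint (X n ω)) ℓ).trans (by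
        rw [hX.norm_direction, mul_one]; exact norm_walk_le hX.start hX.bounded n ω)
    have h3 : K * (n : ℝ) < K * M := by gcongr
    linarith [(abs_le.1 h2).1]
  have hFq : ∀ n, M ≤ n → μ.real (F n) ≤ q n := by
    intro n hn
    have hn1 : 1 ≤ n := by omega
    have hn1' : (1 : ℝ) ≤ n := by exact_mod_cast hn1
    have hn0 : (0 : ℝ) < n := by linarith
    have hsq : ((n : ℝ) ^ (1 / 2 + α)) ^ 2 = n * (n : ℝ) ^ (2 * α) := by
      rw [← Real.rpow_natCast, ← Real.rpow_mul hn0.le]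
      nth_rw 2 [← Real.rpow_one (n : ℝ)]
      rw [← Real.rpow_add hn0]
      congr 1; push_cast; ring
    have hx0 : 0 ≤ x := le_trans (by positivity) hx
    -- Either the initial height alone exceeds the fluctuations, or the at most `m` sites of `P` are
    -- fewer than a quarter of the range.
    rcases le_or_gt ((n : ℝ) ^ (1 / 2 + α)) (4 * m) with hcase | hcase
    · have h1 := measureReal_inner_walk_sub_le (w := fun _ => 0) (W := 0) hK hX (fun _ => le_rfl)
        (fun k => (hX.drift_pos k).le) (fun _ => le_rfl) hn1 hx0
      have h2 : Real.exp (-(x ^ 2 / (2 * n * (K + 0) ^ 2)))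
          ≤ Real.exp (-c₁ * (n : ℝ) ^ (2 * α)) := by
        rw [Real.exp_le_exp, neg_mul, neg_le_neg_iff, add_zero, le_div_iff₀ (by positivity)]
        have h3 : (r * ((n : ℝ) ^ (1 / 2 + α) / 4)) ^ 2 ≤ x ^ 2 := by
          gcongr
          refine le_trans ?_ hx
          gcongr
          linarith
        refine le_trans (le_of_eq ?_) h3
        rw [mul_pow, div_pow, hsq, hc₁]
        field_simp
        norm_num
      have h4 : μ.real (F n) ≤ Real.exp (-c₁ * (n : ℝ) ^ (2 * α)) := by
        refine le_trans (measureReal_mono fun ω hω => ?_) (h1.trans h2)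
        have : inner ℝ (latticePoint (X n ω)) ℓ ≤ -x := hω.2
        simpa using this
      simp only [hq]
      have := Real.exp_pos (-γ₁ * (n : ℝ) ^ γ₂)
      have := Real.exp_pos (-c₂ * (n : ℝ) ^ (2 * (α - β)))
      linarith
    · set N := (n : ℝ) ^ (1 / 2 + α) with hN
      have hN2 : 2 ≤ N := by
        have h4 : (4 : ℝ) ≤ n := by exact_mod_cast hM4.trans hn
        calc (2 : ℝ) = (4 : ℝ) ^ (1 / 2 : ℝ) := by
              rw [← Real.sqrt_eq_rpow, show (4 : ℝ) = 2 ^ 2 by norm_num, Real.sqrt_sq (by norm_num)]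
          _ ≤ (n : ℝ) ^ (1 / 2 : ℝ) := by gcongr
          _ ≤ N := Real.rpow_le_rpow_of_exponent_le hn1' (by linarith)
      have hNn : N ≤ n := by
        calc N ≤ (n : ℝ) ^ (1 : ℝ) := Real.rpow_le_rpow_of_exponent_le hn1' (by linarith)
          _ = n := Real.rpow_one _
      have hmn : (m : ℝ) ≤ n := by linarith
      set w : ℕ → ℝ := fun k => lam * ((n₀ : ℝ) + m + k) ^ (-β) with hw
      have hbase : ∀ k : ℕ, 1 ≤ (n₀ : ℝ) + m + k := fun k => by
        have h1 : (0 : ℝ) ≤ n₀ := Nat.cast_nonneg _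
        have h2 : (0 : ℝ) ≤ k := Nat.cast_nonneg _
        linarith
      have hw0 : ∀ k, 0 ≤ w k := fun k => by
        have := hbase k
        positivity
      have hw1 : ∀ k, w k ≤ lam := fun k =>
        mul_le_of_le_one_right hlam.le
          (Real.rpow_le_one_of_one_le_of_nonpos (hbase k) (by linarith))
      set v := lam * ((B + 2) * n) ^ (-β) with hv
      have hv0 : 0 < v := by positivity
      have hwv : ∀ k < n, v ≤ w k := fun k hk => by
        have h1 : (k : ℝ) ≤ n := by exact_mod_cast hk.le
        have h2 : (n₀ : ℝ) + m + k ≤ (B + 2) * n := by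
          have : B * m ≤ B * n := by gcongr
          linarith
        have h3 := hbase k
        exact mul_le_mul_of_nonneg_left
          (Real.rpow_le_rpow_of_nonpos (by linarith) h2 (by linarith)) hlam.le
      have h1 := measureReal_inner_walk_sub_le hK hX hw0 hdrift hw1 hn1
        (a := v * (N / 4)) (by positivity)
      have h2 := hR.bound Ω mΩ μ ℱ drift ℓ A X hX n hn1
      have hsub : F n ⊆ {ω | ((visitedSites X n ω).card : ℝ) < N} ∪
          {ω | inner ℝ (latticePoint (X n ω)) ℓ
            - ∑ k ∈ Finset.range n, w k * excitation A X k ω ≤ -(v * (N / 4))} := by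
        rintro ω ⟨hω1, hω2⟩
        by_cases hcard : ((visitedSites X n ω).card : ℝ) < N
        · exact Or.inl hcard
        · refine Or.inr ?_
          have h3 := card_visitedSites_le_sum_excitation (A := A) (X := X) (P := P) (n := n)
            (ω := ω) fun k hk => hAP _ (hω1 k hk)
          have h4 : (P.card : ℝ) ≤ m := by exact_mod_cast hP
          -- From `N ≤ 1 + m + ∑`, `m < N / 4` and `N ≥ 2`.
          have h5 : N / 4 ≤ ∑ k ∈ Finset.range n, excitation A X k ω := by linarith
          have h6 : v * (N / 4) ≤ ∑ k ∈ Finset.range n, w k * excitation A X k ω := by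
            calc v * (N / 4) ≤ v * ∑ k ∈ Finset.range n, excitation A X k ω := by gcongr
              _ ≤ _ := by
                rw [Finset.mul_sum]
                exact Finset.sum_le_sum fun k hk => mul_le_mul_of_nonneg_right
                  (hwv k (Finset.mem_range.1 hk)) (excitation_nonneg A X k ω)
          rw [Set.mem_ofPred_eq]
          linarith
      have h3 : Real.exp (-((v * (N / 4)) ^ 2 / (2 * n * (K + lam) ^ 2)))
          = Real.exp (-c₂ * (n : ℝ) ^ (2 * (α - β))) := by
        have e1 : v = lam * (B + 2) ^ (-β) * (n : ℝ) ^ (-β) := by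
          rw [hv, Real.mul_rpow (by positivity) hn0.le, mul_assoc]
        have e2 : (n : ℝ) ^ (2 * (α - β)) = ((n : ℝ) ^ (-β)) ^ 2 * (n : ℝ) ^ (2 * α) := by
          rw [← Real.rpow_natCast ((n : ℝ) ^ (-β)), ← Real.rpow_mul hn0.le, ← Real.rpow_add hn0]
          congr 1; push_cast; ring
        have e3 : (v * (N / 4)) ^ 2 = (lam * (B + 2) ^ (-β) / 4) ^ 2
            * (((n : ℝ) ^ (-β)) ^ 2 * (n * (n : ℝ) ^ (2 * α))) := by
          rw [e1, ← hsq]; ring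
        congr 1
        rw [e3, e2, hc₂]
        field_simp
      have h4 : μ.real (F n) ≤ Real.exp (-γ₁ * (n : ℝ) ^ γ₂)
          + Real.exp (-c₂ * (n : ℝ) ^ (2 * (α - β))) := by
        refine (measureReal_mono hsub).trans ((measureReal_union_le _ _).trans ?_)
        rw [← h3]
        exact add_le_add h2.le h1
      simp only [hq]
      have := Real.exp_pos (-c₁ * (n : ℝ) ^ (2 * α))
      linarith
  have h1 := measureReal_iUnion_le_half (μ := μ) hqs hq0 hM1 hempty hFq
  have h2 := (measureReal_mono hcompl).trans h1
  have hmeas : MeasurableSet {ω | ∀ n, -x < inner ℝ (latticePoint (X n ω)) ℓ} := by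
    rw [Set.ofPred_forall]
    exact MeasurableSet.iInter fun n => ℱ.le n _
      (measurableSet_walk_mem hX.adapted le_rfl {z | -x < inner ℝ (latticePoint z) ℓ})
  rw [probReal_compl_eq_one_sub hmeas] at h2
  linarith

/-! ### Escape after a run of pushes -/

/-- A comparison of measures can be checked on the fibres of a map to a countable space. -/
theorem measure_le_of_forall_fiber {Ω β : Type*} {mΩ : MeasurableSpace Ω} [MeasurableSpace β]
    [Countable β] [MeasurableSingletonClass β] {μ : Measure Ω} {S T : Set Ω} (c : ENNReal)
    {W : Ω → β} (hW : Measurable W)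
    (hle : ∀ b, μ (W ⁻¹' {b} ∩ S) ≤ c * μ (W ⁻¹' {b} ∩ T)) : μ S ≤ c * μ T := by
  have key : ∀ R : Set Ω, ∑' b : β, μ (W ⁻¹' {b} ∩ R) = μ R := fun R => by
    have h1 := tsum_measure_preimage_singleton (μ := μ.restrict R) (f := W)
      (Set.countable_univ (α := β)) fun b _ => hW (measurableSet_singleton b)
    rw [tsum_univ (fun b => μ.restrict R (W ⁻¹' {b}))] at h1
    simpa [Measure.restrict_apply (hW (measurableSet_singleton _))] using h1
  rw [← key S, ← key T, ← ENNReal.tsum_mul_left]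
  exact ENNReal.tsum_le_tsum hle

section Escape

variable {d : ℕ} {Ω : Type u} {mΩ : MeasurableSpace Ω} {μ : Measure Ω} [IsProbabilityMeasure μ]
  {ℱ : Filtration ℕ mΩ}
  {K h r : ℝ} {drift : ℕ → ℝ} {ℓ : EuclideanSpace ℝ (Fin d)} {A : Set (Fin d → ℤ)}
  {X : ℕ → Ω → (Fin d → ℤ)}

/-- If every restart after `m` pushes survives with probability at least one half, then the walk
escapes with probability at least `h ^ m / 2`. -/
theorem half_pow_le_measureReal_escape (hh : 0 < h) (hr : 0 < r)
    (hX : IsGERW μ ℱ K h r drift ℓ A X) (hA : positiveHalfSpace ℓ ⊆ A) {m : ℕ} (hm : 1 ≤ m)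
    (hstay : ∀ (ν : Measure Ω) [IsProbabilityMeasure ν] (ℱ' : Filtration ℕ mΩ)
      (A' : Set (Fin d → ℤ)) (Y : ℕ → Ω → (Fin d → ℤ)),
      IsGERW ν ℱ' K h r (fun n => drift (m + n)) ℓ A' Y →
      ∀ (x : ℝ) (P : Finset (Fin d → ℤ)), r * m ≤ x → P.card ≤ m →
      (∀ z, -x < inner ℝ (latticePoint z) ℓ → z ∈ A' ∨ z ∈ P) →
      1 / 2 ≤ ν.real {ω | ∀ n, -x < inner ℝ (latticePoint (Y n ω)) ℓ}) :
    h ^ m / 2 ≤ μ.real {ω | ∀ n : ℕ, 1 ≤ n → 0 < inner ℝ (latticePoint (X n ω)) ℓ} := by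
  set G := {ω | ∀ n : ℕ, 1 ≤ n → 0 < inner ℝ (latticePoint (X n ω)) ℓ} with hG
  set W : Ω → (Fin (m + 1) → (Fin d → ℤ)) := fun ω k => X k ω with hW
  have hWm : Measurable[ℱ m] W := @measurable_pi_lambda _ _ _ (ℱ m) _ _ fun k =>
    (hX.adapted k).mono (ℱ.mono (Nat.lt_succ_iff.1 k.2)) le_rfl
  have hWm' : Measurable W := hWm.mono (ℱ.le m) le_rfl
  -- A fibre fixes the path up to time `m`. If it meets the push event, every walk in it has made
  -- the `m` pushes, and the restart applies conditionally on the fibre.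
  have hfib : ∀ b, μ (W ⁻¹' {b} ∩ pushEvent r ℓ X m) ≤ 2 * μ (W ⁻¹' {b} ∩ G) := by
    intro b
    set E := W ⁻¹' {b} with hE
    have hEm : MeasurableSet[ℱ m] E := hWm (measurableSet_singleton b)
    rcases Set.eq_empty_or_nonempty (E ∩ pushEvent r ℓ X m) with hemp | ⟨ω₀, hω₀E, hω₀⟩
    · simp [hemp]
    by_cases hE0 : μ E = 0
    · rw [measure_mono_null Set.inter_subset_left hE0]; exact zero_le
    set w : ℕ → (Fin d → ℤ) := fun k => X k ω₀ with hw
    have hpath : ∀ ω ∈ E, ∀ k ≤ m, X k ω = w k := by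
      intro ω hω k hk
      have h1 : W ω = W ω₀ := hω.trans hω₀E.symm
      exact congrFun h1 ⟨k, Nat.lt_succ_iff.2 hk⟩
    have hpos : ∀ k : ℕ, k ≤ m → r * k ≤ inner ℝ (latticePoint (w k)) ℓ := fun k hk => by
      have := inner_add_le_of_mem_pushEvent hω₀ (Nat.zero_le k) hk
      simpa [hX.start] using this
    have hm0 : (0 : ℝ) < m := by exact_mod_cast hm
    have hwA : w m ∈ A := hA (lt_of_lt_of_le (by positivity) (hpos m le_rfl))
    have hwne : ∀ k < m, w m ≠ w k := fun k hk =>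
      (walk_ne_of_mem_pushEvent hr hω₀ hk le_rfl).symm
    have hprob : IsProbabilityMeasure (cond μ E) := cond_isProbabilityMeasure hE0
    have h1 := hstay (cond μ E) (shiftFiltration ℱ m) _ _
      (isGERW_restart hX hEm hE0 hpath hwA hwne) (inner ℝ (latticePoint (w m)) ℓ)
      ((Finset.range m).image fun k => w k - w m) (hpos m le_rfl)
      (Finset.card_image_le.trans (by simp)) (fun z hz => by
        by_cases hzP : ∃ k < m, z + w m = w k
        · obtain ⟨k, hk, hkz⟩ := hzP
          exact Or.inr (Finset.mem_image.2 ⟨k, Finset.mem_range.2 hk, by rw [← hkz]; simp⟩)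
        · push Not at hzP
          refine Or.inl ⟨hA ?_, hzP⟩
          have : latticePoint (z + w m) = latticePoint z + latticePoint (w m) := by
            ext i; simp [latticePoint]
          change 0 < inner ℝ (latticePoint (z + w m)) ℓ
          rw [this, inner_add_left]
          linarith)
    have h2 : E ∩ {ω | ∀ n, -inner ℝ (latticePoint (w m)) ℓ
        < inner ℝ (latticePoint (X (m + n) ω - X m ω)) ℓ} ⊆ E ∩ G := by
      rintro ω ⟨hωE, hω⟩
      refine ⟨hωE, fun n hn => ?_⟩
      rcases le_or_gt n m with hnm | hnm
      · rw [hpath ω hωE n hnm]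
        have hn0 : (0 : ℝ) < n := by exact_mod_cast hn
        exact lt_of_lt_of_le (by positivity) (hpos n hnm)
      · obtain ⟨j, rfl⟩ := Nat.exists_eq_add_of_le hnm.le
        have h3 := hω j
        rw [latticePoint_sub, inner_sub_left, hpath ω hωE m le_rfl] at h3
        linarith
    have h3 : (1 / 2 : ℝ) ≤ (cond μ E).real G := by
      refine h1.trans ?_
      rw [measureReal_def, measureReal_def, cond_apply (ℱ.le m _ hEm),
        cond_apply (ℱ.le m _ hEm)]
      refine ENNReal.toReal_mono ?_ (by gcongr)
      exact ENNReal.mul_ne_top (ENNReal.inv_ne_top.2 hE0) (measure_ne_top _ _)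
    have h4 : μ.real E ≤ 2 * μ.real (E ∩ G) := by
      rw [measureReal_def, cond_apply (ℱ.le m _ hEm), ENNReal.toReal_mul, ENNReal.toReal_inv] at h3
      have h5 : 0 < μ.real E := ENNReal.toReal_pos hE0 (measure_ne_top _ _)
      rw [← measureReal_def, ← measureReal_def, inv_mul_eq_div, le_div_iff₀ h5] at h3
      linarith
    refine (measure_mono Set.inter_subset_left).trans ?_
    rw [← ofReal_measureReal (μ := μ) (s := E), ← ofReal_measureReal (μ := μ) (s := E ∩ G),
      show (2 : ENNReal) = ENNReal.ofReal 2 by simp, ← ENNReal.ofReal_mul (by norm_num)]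
    exact ENNReal.ofReal_le_ofReal h4
  have h1 := measure_le_of_forall_fiber 2 hWm' hfib
  have h2 : μ.real (pushEvent r ℓ X m) ≤ 2 * μ.real G := by
    have := ENNReal.toReal_mono (ENNReal.mul_ne_top (by simp) (measure_ne_top μ G)) h1
    simpa [measureReal_def] using this
  linarith [pow_le_measureReal_pushEvent hh hX m]

end Escape

end GERW

/-! ### The main theorem: choice of the constants -/

theorem proposition3 (d : ℕ) (hd : 2 ≤ d) (K h r : ℝ) (hK : 0 < K) (hh : 0 < h) (hr : 0 < r) :
    (∃ α γ₁ γ₂ : ℝ, IsRangeExponent.{u} d K h r α γ₁ γ₂) ∧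
    ∀ α γ₁ γ₂ : ℝ, IsRangeExponent.{u} d K h r α γ₁ γ₂ →
    ∀ β lam : ℝ, β < α → 0 < lam →
    ∃ C₀ c : ℝ,
      K ^ (1 / (deltaExp α β - 1)) *
        (etaConst K lam α β γ₁ γ₂ + (⌈r⁻¹⌉₊ : ℝ) ^ (1 / (deltaExp α β - 1))) ≤ C₀ ∧
      0 < c ∧ c < 1 ∧
      ∀ (n₀ : ℕ) (C : ℝ), C₀ + n₀ ≤ C →
        0 < psiConst h r lam α β C c ∧
        ∀ (Ω : Type u) (mΩ : MeasurableSpace Ω) (μ : Measure Ω) [IsProbabilityMeasure μ]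
          (ℱ : Filtration ℕ mΩ) (drift : ℕ → ℝ) (ℓ : EuclideanSpace ℝ (Fin d))
          (A : Set (Fin d → ℤ)) (X : ℕ → Ω → (Fin d → ℤ)),
          IsGERW μ ℱ K h r drift ℓ A X →
          positiveHalfSpace ℓ ⊆ A →
          (∀ n : ℕ, 1 ≤ n → lam * ((n₀ : ℝ) + n) ^ (-β) ≤ drift n) →
          psiConst h r lam α β C c
            ≤ μ.real {ω | ∀ n : ℕ, 1 ≤ n → 0 < inner ℝ (latticePoint (X n ω)) ℓ} := by
  refine ⟨GERW.exists_isRangeExponent hd hK hh hr, fun α γ₁ γ₂ hR β lam hβ hlam => ?_⟩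
  set s := (⌈r⁻¹⌉₊ : ℝ) * (3 / lam) ^ (1 / (deltaExp α β - 1)) with hs
  have hs0 : 0 < s := by
    have : 0 < ⌈r⁻¹⌉₊ := Nat.ceil_pos.2 (inv_pos.2 hr)
    positivity
  -- Passing from `β` to `max β 0` keeps it below `α` and only weakens the drift bound, as the base
  -- is at least one. The ratio `s⁻¹` bounds `n₀ / m` for the `m` chosen below.
  obtain ⟨m₀, hm₀, hstay⟩ := GERW.exists_half_le_measureReal_stay.{u} hK hr hR
    (le_max_right β 0) (max_lt hβ hR.pos) hlam (inv_pos.2 hs0)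
  -- Because `c` absorbs the cost of the first `m₀` pushes, `C₀` needs only its prescribed lower
  -- bound; the maximum with `0` ensures `n₀ ≤ C`.
  refine ⟨max (K ^ (1 / (deltaExp α β - 1)) *
      (etaConst K lam α β γ₁ γ₂ + (⌈r⁻¹⌉₊ : ℝ) ^ (1 / (deltaExp α β - 1)))) 0,
    min (1 / 2) (h ^ m₀ / 2), le_max_left _ _, by positivity,
    (min_le_left _ _).trans_lt (by norm_num), fun n₀ C hC => ⟨?_, ?_⟩⟩
  · unfold psiConst
    positivity
  intro Ω mΩ μ _ ℱ drift ℓ A X hX hA hdrift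
  have hh1 := GERW.ellipticity_le_one hh hX
  -- The first summand makes `n₀ ≤ m / s` and costs `h ^ ⌊s * n₀⌋₊ ≥ h ^ (s * C)`; the second
  -- reaches the threshold and is paid by `c`.
  set m := ⌊s * n₀⌋₊ + m₀ with hm
  have hm₀m : m₀ ≤ m := Nat.le_add_left _ _
  have hn₀ : (n₀ : ℝ) ≤ s⁻¹ * m := by
    rw [inv_mul_eq_div, le_div_iff₀ hs0, mul_comm, hm]
    have h1 := (Nat.lt_floor_add_one (s * n₀)).le
    have h2 : (1 : ℝ) ≤ m₀ := by exact_mod_cast hm₀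
    push_cast
    linarith
  have h1 := GERW.half_pow_le_measureReal_escape hh hr hX hA (hm₀.trans hm₀m)
    fun ν _ ℱ' A' Y hY x P hx hP hAP => hstay m hm₀m n₀ hn₀ Ω mΩ ν ℱ' _ ℓ A' Y hY (fun n => by
      refine le_trans ?_ (hdrift (m + n) (by omega))
      have h2 : (1 : ℝ) ≤ m := by exact_mod_cast hm₀.trans hm₀m
      have h3 : (0 : ℝ) ≤ n₀ := Nat.cast_nonneg _
      have h4 : (0 : ℝ) ≤ n := Nat.cast_nonneg _
      push_cast
      rw [← add_assoc]
      exact mul_le_mul_of_nonneg_left (Real.rpow_le_rpow_of_exponent_le (by linarith)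
        (neg_le_neg (le_max_left β 0))) hlam.le) x P hx hP hAP
  refine le_trans ?_ h1
  have hCn : (n₀ : ℝ) ≤ C := le_trans (le_add_of_nonneg_left (le_max_right _ _)) hC
  have hexp : h ^ ((⌈r⁻¹⌉₊ : ℝ) * C * (3 / lam) ^ (1 / (deltaExp α β - 1))) ≤ h ^ ⌊s * n₀⌋₊ := by
    rw [← Real.rpow_natCast]
    refine Real.rpow_le_rpow_of_exponent_ge hh hh1 ?_
    calc ((⌊s * n₀⌋₊ : ℕ) : ℝ) ≤ s * n₀ := Nat.floor_le (by positivity)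
      _ ≤ s * C := by gcongr
      _ = _ := by rw [hs]; ring
  unfold psiConst
  calc _ ≤ h ^ ⌊s * n₀⌋₊ * (h ^ m₀ / 2) := by
        gcongr
        exact min_le_right _ _
    _ = h ^ m / 2 := by rw [hm, pow_add]; ring
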